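/- **Setting.** Let $X,Y,Z$ be the Pauli matrices and $\boldsymbol x,\boldsymbol z$ unit vectors along the $x$- and $z$-axes. For a Hermitian $2\times2$ matrix $M$ its Bloch vector is $(\mathrm{Tr}[XM],\mathrm{Tr}[YM],\mathrm{Tr}[ZM])\in\mathbb R^3$. Let $\rho_1\ne\rho_2$ and $\bar\rho_1,\bar\rho_2$ be qubit density matrices and $\pi_1,\pi_2\ge0$ with $\pi_1+\pi_2=1$. For a completely positive trace preserving (CPTP) linear map $\mathcal C$ on $2\times2$ complex matrices put $$\mathcal F(\mathcal C)=\pi_1\mathrm{Tr}[\mathcal C(\rho_1)\bar\rho_1]+\pi_2\mathrm{Tr}[\mathcal C(\rho_2)\bar\rho_2].$$ Let $\boldsymbol R_i$ be the Bloch vector of $\rho_i$ and $\bar{\boldsymbol R}_i$ that of $\pi_i\bar\rho_i$. Write $R_-=\|\boldsymbol R_1-\boldsymbol R_2\|$, $R_\times=\|\boldsymbol R_1\times\boldsymbol R_2\|$, $\bar R_+=\|\bar{\boldsymbol R}_1+\bar{\boldsymbol R}_2\|$, $\bar R_\times=\|\bar{\boldsymbol R}_1\times\bar{\boldsymbol R}_2\|$,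 $\bar R_i=\|\bar{\boldsymbol R}_i\|$, $r_i=\boldsymbol R_i\cdot(\boldsymbol R_1-\boldsymbol R_2)$, $$T=\sum_{i,j=1}^2(1-\boldsymbol R_i\cdot\boldsymbol R_j)(\bar{\boldsymbol R}_i\cdot\bar{\boldsymbol R}_j),\quad S=\sqrt{T^2+4\bar R_\times^2(R_-^2-R_\times^2)},\quad \Omega=S+T-2\bar R_\times R_\times.$$ For $\alpha,\beta_1,\beta_2\in\mathbb R$ let $$\Gamma(\alpha,\beta)=\sqrt{\alpha^2\bar R_+^2+\left[\|\beta_1\bar{\boldsymbol R}_1+\beta_2\bar{\boldsymbol R}_2\|^2+2\alpha(\beta_1-\beta_2)\right]\bar R_\times^2},$$ $$k_{ij}(\alpha,\beta)=\tfrac{1}{\Gamma(\alpha,\beta)}\left[\alpha^2+\beta_i\beta_j\bar R_\times^2+(-1)^{i+j}\alpha(\beta_1-\beta_2)\,\bar{\boldsymbol R}_{\tilde i}\cdot\bar{\boldsymbol R}_{\tilde j}\right],\qquad \tilde1=2,\ \tilde2=1.$$ **Step 1 (both procedures).** $V$ is a unitary such that $V\rho_iV^\dagger$ has Bloch vector $\boldsymbol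 R_i'=\frac{R_\times}{R_-}\boldsymbol x+\frac{r_i}{R_-}\boldsymbol z$ for $i=1,2$. **Procedure A.** $\mathcal C(M)=U\,\mathcal D(VMV^\dagger)\,U^\dagger$. Here $\mathcal D$ is the trace preserving linear map acting on Bloch vectors of states by multiplying the $x,y,z$ components by $\mu_1,\mu_2,\mu_3$ and then adding $s_1$ to the $x$ component, with $$\mu_1=2\sqrt{\tfrac{2}{S(S+T)^3}}\,\bar R_\times^2R_\times R_-,\quad \mu_2=\tfrac{2}{S+T}\bar R_\times R_\times,\quad \mu_3=\sqrt{\tfrac{2}{S(S+T)}}\,\bar R_\times R_-,\quad s_1=\sqrt{\tfrac{1}{2S(S+T)^3}}\left[(S+T)^2-4\bar R_\times^2R_\times^2\right],$$ and $U$ is a unitary such that $\mathcal C(\rho_i)$ has Bloch vector $k_{i1}\bar{\boldsymbol R}_1+k_{i2}\bar{\boldsymbol R}_2$ ($i=1,2$), where $k_{ij}=k_{ij}(\alpha,\beta)$ with $\alpha=\alpha^A=\sqrt{\frac{S+T}{2S}}$, $\beta_i=\beta_i^A=\sqrt{\frac{2}{S(S+T)}}\,r_i$. **Procedure B.** $\mathcal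 C(M)=UVMV^\dagger U^\dagger$ with $U$ unitary. If $\bar R_\times\ne0$, $U$ is such that $\mathcal C(\rho_i)$ has Bloch vector $k_{i1}\bar{\boldsymbol R}_1+k_{i2}\bar{\boldsymbol R}_2$ ($i=1,2$), where $k_{ij}=k_{ij}(\alpha,\beta)$ with $\alpha=\alpha^B=\frac{R_\times}{R_-}$, $\beta_i=\beta_i^B=\frac{r_i}{\bar R_\times R_-}$. If $\bar R_\times=0$, then $U=WU_0$ with $U_0,W$ unitary. Here $U_0$ takes $\boldsymbol R_i'$ to $$\left[\tfrac{R_\times}{R_-}\cos\vartheta-\tfrac{r_i}{R_-}\sin\vartheta\right]\boldsymbol x+\left[\tfrac{R_\times}{R_-}\sin\vartheta+\tfrac{r_i}{R_-}\cos\vartheta\right]\boldsymbol z,\qquad \sin\vartheta=\frac{R_\times(\bar R_1-\bar R_2)}{R_-\sqrt{\bar R_+^2-T}},\quad\cos\vartheta=\sqrt{1-\sin^2\vartheta}$$ (with $\vartheta=0$ if $\bar{\boldsymbol R}_1=\bar{\boldsymbol R}_2=0$), and $W$ rotates the $z$-axis to a unit vector $\boldsymbol n$ with $\bar{\boldsymbol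 R}_1=\bar R_1\boldsymbol n$ and $\bar{\boldsymbol R}_2=-\bar R_2\boldsymbol n$. **Theorem.** One has $R_->0$ and $R_\times<R_-$. Put $$\Gamma_a=\sqrt{\bar R_+^2+\tfrac{2R_-^2\bar R_\times^2}{S+T}},\qquad \Gamma_b=\sqrt{\bar R_+^2-T+2R_\times\bar R_\times}.$$ 1. If $\Omega>0$, procedure A is well defined ($S>0$, $S+T>0$, $\mu_1,\mu_2,\mu_3\in[0,1]$ and $\Gamma(\alpha^A,\beta^A)=\Gamma_a>0$), and a map $\mathcal C$ as prescribed by it exists. Every such $\mathcal C$ is CPTP, maximizes $\mathcal F$ over all CPTP maps, and has $\mathcal F(\mathcal C)=\frac12+\frac12\Gamma_a$. It is an extreme point of the convex set of qubit CPTP maps and is not of the form $M\mapsto WMW^\dagger$ with $W$ unitary. 2. If $\Omega\le0$, procedure B is well defined: the radicand in $\Gamma_b$ is nonnegative; if $\bar R_\times\neq0$, then $\Gamma(\alpha^B,\beta^B)=\Gamma_b>0$; if $\bar R_\times=0$, then $|\sin\vartheta|\le1$, and $\bar R_+^2-T>0$ unless $\bar{\boldsymbol R}_1=\bar{\boldsymbol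 R}_2=0$. A map $\mathcal C$ as prescribed by it exists. Every such $\mathcal C$ is a unitary channel, maximizes $\mathcal F$ over all CPTP maps, and has $\mathcal F(\mathcal C)=\frac12+\frac12\Gamma_b$. -/

import Mathlib

noncomputable section

namespace QubitTracking

open scoped ComplexOrder Matrix

/-! ### Qubit states and quantum operations -/

/-- Operators on a single qubit. -/
abbrev Op : Type := Matrix (Fin 2) (Fin 2) ℂ

/-- Qubit density matrices: positive semidefinite with unit trace. -/
def IsDensity (ρ : Op) : Prop := ρ.PosSemidef ∧ ρ.trace = 1

/-- `id_k ⊗ C`, acting on operators on `ℂ^k ⊗ ℂ²`: the map `C` is applied to each of the `k × k`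
blocks of size `2 × 2`. -/
def amplify (k : ℕ) (C : Op →ₗ[ℂ] Op) (M : Matrix (Fin k × Fin 2) (Fin k × Fin 2) ℂ) :
    Matrix (Fin k × Fin 2) (Fin k × Fin 2) ℂ :=
  Matrix.of fun a b => C (Matrix.of fun i j => M (a.1, i) (b.1, j)) a.2 b.2

/-- Quantum operations: completely positive and trace preserving linear maps. -/
def IsCPTP (C : Op →ₗ[ℂ] Op) : Prop :=
  (∀ (k : ℕ) (M : Matrix (Fin k × Fin 2) (Fin k × Fin 2) ℂ),
    M.PosSemidef → (amplify k C M).PosSemidef) ∧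
  ∀ M : Op, (C M).trace = M.trace

/-- The map `M ↦ W M W†`. -/
def conjMap (W : Op) : Op →ₗ[ℂ] Op where
  toFun M := W * M * Wᴴ
  map_add' M N := by rw [Matrix.mul_add, Matrix.add_mul]
  map_smul' c M := by simp

/-- Unitary `2 × 2` matrices. -/
def IsUnitary (W : Op) : Prop := W ∈ Matrix.unitaryGroup (Fin 2) ℂ

/-- The averaged Hilbert-Schmidt inner product `∑ᵢ πᵢ Tr[C(ρᵢ) ρ̄ᵢ]` (the traces are real for
the maps of interest; the real part is taken to obtain a real number). -/
def merit (ρ ρb : Fin 2 → Op) (p : Fin 2 → ℝ) (C : Op →ₗ[ℂ] Op) : ℝ :=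
  ∑ i, p i * ((C (ρ i) * ρb i).trace).re

/-- `C` is a quantum operation which maximizes the figure of merit among all quantum operations. -/
def IsOptimal (ρ ρb : Fin 2 → Op) (p : Fin 2 → ℝ) (C : Op →ₗ[ℂ] Op) : Prop :=
  IsCPTP C ∧ ∀ C' : Op →ₗ[ℂ] Op, IsCPTP C' → merit ρ ρb p C' ≤ merit ρ ρb p C

/-! ### Bloch vectors -/

/-- Three dimensional Euclidean space. -/
abbrev Vec : Type := EuclideanSpace ℝ (Fin 3)

def pauliX : Op := !![0, 1; 1, 0]
def pauliY : Op := !![0, -Complex.I; Complex.I, 0]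
def pauliZ : Op := !![1, 0; 0, -1]

/-- The Bloch vector `(Tr[X M], Tr[Y M], Tr[Z M])` of a Hermitian matrix, so that
`M = (Tr[M] 1 + b · σ) / 2`. -/
def bloch (M : Op) : Vec :=
  !₂[((pauliX * M).trace).re, ((pauliY * M).trace).re, ((pauliZ * M).trace).re]

/-- `n · σ`. -/
def dotPauli (n : Vec) : Op :=
  (n 0 : ℂ) • pauliX + (n 1 : ℂ) • pauliY + (n 2 : ℂ) • pauliZ

def xAxis : Vec := !₂[1, 0, 0]
def zAxis : Vec := !₂[0, 0, 1]

/-- `‖v₁ + v₂‖`. -/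
def plusNorm (v : Fin 2 → Vec) : ℝ := ‖v 0 + v 1‖

/-- `‖v₁ - v₂‖`. -/
def minusNorm (v : Fin 2 → Vec) : ℝ := ‖v 0 - v 1‖

/-- `‖v₁ × v₂‖`. -/
def crossNorm (v : Fin 2 → Vec) : ℝ :=
  ‖(WithLp.toLp 2 (crossProduct (v 0).ofLp (v 1).ofLp) : Vec)‖

/-! ### The indicator function

Here and below `R` is the pair of source Bloch vectors (of `ρ₁`, `ρ₂`), and `B` the pair of target
Bloch vectors (of `π₁ ρ̄₁`, `π₂ ρ̄₂`). -/

def paramT (R B : Fin 2 → Vec) : ℝ :=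
  ∑ i, ∑ j, (1 - inner ℝ (R i) (R j)) * inner ℝ (B i) (B j)

def paramS (R B : Fin 2 → Vec) : ℝ :=
  √(paramT R B ^ 2 + 4 * crossNorm B ^ 2 * (minusNorm R ^ 2 - crossNorm R ^ 2))

def indicator (R B : Fin 2 → Vec) : ℝ :=
  paramS R B + paramT R B - 2 * crossNorm B * crossNorm R

/-! ### Step 1 (both procedures) -/

/-- `Rᵢ · R₋`. -/
def projR (R : Fin 2 → Vec) (i : Fin 2) : ℝ := inner ℝ (R i) (R 0 - R 1)

/-- The unitary `V` takes the source Bloch vectors to the `xz`-plane, where they share the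
`x`-component `R× / R₋ ≥ 0` and have `z`-components `(Rᵢ · R₋) / R₋`. -/
def IsStepOne (ρ : Fin 2 → Op) (V : Op) : Prop :=
  let R : Fin 2 → Vec := fun i => bloch (ρ i)
  IsUnitary V ∧ ∀ i, bloch (conjMap V (ρ i)) =
    (crossNorm R / minusNorm R) • xAxis + (projR R i / minusNorm R) • zAxis

/-! ### The rotation into the plane of the targets -/

/-- The quantity `Γ` as a function of `α`, `β₁`, `β₂`. -/
def gamma (B : Fin 2 → Vec) (α : ℝ) (β : Fin 2 → ℝ) : ℝ :=
  √(α ^ 2 * plusNorm B ^ 2 +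
    (‖β 0 • B 0 + β 1 • B 1‖ ^ 2 + 2 * α * (β 0 - β 1)) * crossNorm B ^ 2)

/-- The coefficients `kᵢⱼ`; `Fin.rev` exchanges the two indices. -/
def coeffK (B : Fin 2 → Vec) (α : ℝ) (β : Fin 2 → ℝ) (i j : Fin 2) : ℝ :=
  (α ^ 2 + β i * β j * crossNorm B ^ 2 +
    (-1) ^ (i.val + j.val) * α * (β 0 - β 1) * inner ℝ (B i.rev) (B j.rev)) / gamma B α β

/-! ### Procedure A -/

/-- The linear map which acts on Bloch vectors (of unit trace matrices) by multiplying the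
`x`, `y`, `z` components by `m₁`, `m₂`, `m₃` and then adding `s` to the `x` component. -/
def affineMap (m₁ m₂ m₃ s : ℝ) : Op →ₗ[ℂ] Op where
  toFun M := (1 / 2 : ℂ) • (M.trace • (1 + (s : ℂ) • pauliX) +
    ((m₁ : ℂ) * (pauliX * M).trace) • pauliX + ((m₂ : ℂ) * (pauliY * M).trace) • pauliY +
    ((m₃ : ℂ) * (pauliZ * M).trace) • pauliZ)
  map_add' M N := by
    simp only [Matrix.trace_add, mul_add, add_smul, smul_add]
    abel
  map_smul' c M := by
    simp only [Matrix.mul_smul, Matrix.trace_smul, smul_add, smul_smul, smul_eq_mul,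
      RingHom.id_apply]
    congr 1
    · congr 1
      · congr 1
        · congr 2 <;> ring
        · congr 1; ring
      · congr 1; ring
    · congr 1; ring

def mu₁ (R B : Fin 2 → Vec) : ℝ :=
  2 * √(2 / (paramS R B * (paramS R B + paramT R B) ^ 3)) *
    crossNorm B ^ 2 * crossNorm R * minusNorm R

def mu₂ (R B : Fin 2 → Vec) : ℝ :=
  2 / (paramS R B + paramT R B) * crossNorm B * crossNorm R

def mu₃ (R B : Fin 2 → Vec) : ℝ :=
  √(2 / (paramS R B * (paramS R B + paramT R B))) * crossNorm B * minusNorm R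

def shift (R B : Fin 2 → Vec) : ℝ :=
  √(1 / (2 * paramS R B * (paramS R B + paramT R B) ^ 3)) *
    ((paramS R B + paramT R B) ^ 2 - 4 * crossNorm B ^ 2 * crossNorm R ^ 2)

/-- The channel `𝒟` of step 2. -/
def channelD (R B : Fin 2 → Vec) : Op →ₗ[ℂ] Op :=
  affineMap (mu₁ R B) (mu₂ R B) (mu₃ R B) (shift R B)

def alphaA (R B : Fin 2 → Vec) : ℝ := √((paramS R B + paramT R B) / (2 * paramS R B))

def betaA (R B : Fin 2 → Vec) (i : Fin 2) : ℝ :=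
  √(2 / (paramS R B * (paramS R B + paramT R B))) * projR R i

def gammaA (R B : Fin 2 → Vec) : ℝ :=
  √(plusNorm B ^ 2 + 2 * minusNorm R ^ 2 * crossNorm B ^ 2 / (paramS R B + paramT R B))

/-- `C` is a map `M ↦ U 𝒟(V M V†) U†` as prescribed by procedure A. -/
def IsProcedureA (ρ : Fin 2 → Op) (B : Fin 2 → Vec) (C : Op →ₗ[ℂ] Op) : Prop :=
  let R : Fin 2 → Vec := fun i => bloch (ρ i)
  ∃ V U : Op, IsStepOne ρ V ∧ IsUnitary U ∧
    (∀ i, bloch (conjMap U (channelD R B (conjMap V (ρ i)))) =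
      ∑ j, coeffK B (alphaA R B) (betaA R B) i j • B j) ∧
    C = conjMap U ∘ₗ channelD R B ∘ₗ conjMap V

/-! ### Procedure B -/

def alphaB (R : Fin 2 → Vec) : ℝ := crossNorm R / minusNorm R

def betaB (R B : Fin 2 → Vec) (i : Fin 2) : ℝ := projR R i / (crossNorm B * minusNorm R)

def gammaB (R B : Fin 2 → Vec) : ℝ :=
  √(plusNorm B ^ 2 - paramT R B + 2 * crossNorm R * crossNorm B)

/-- `sin ϑ`. When both target Bloch vectors vanish, this is `0 / 0 = 0`, that is `ϑ = 0`. -/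
def sinTheta (R B : Fin 2 → Vec) : ℝ :=
  crossNorm R * (‖B 0‖ - ‖B 1‖) / (minusNorm R * √(plusNorm B ^ 2 - paramT R B))

/-- `cos ϑ`. -/
def cosTheta (R B : Fin 2 → Vec) : ℝ := √(1 - sinTheta R B ^ 2)

/-- The unitary `U` of procedure B for linearly independent target Bloch vectors. -/
def IsRotationGeneric (ρ : Fin 2 → Op) (B : Fin 2 → Vec) (V U : Op) : Prop :=
  let R : Fin 2 → Vec := fun i => bloch (ρ i)
  IsUnitary U ∧ ∀ i, bloch (conjMap U (conjMap V (ρ i))) =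
    ∑ j, coeffK B (alphaB R) (betaB R B) i j • B j

/-- The unitary `U` of procedure B for antiparallel target Bloch vectors, `R̄₁ = ‖R̄₁‖ n` and
`R̄₂ = -‖R̄₂‖ n`: a rotation by `ϑ` in the `xz`-plane followed by a rotation `W` which takes the
`z`-axis to the direction `n`. -/
def IsRotationAntiparallel (ρ : Fin 2 → Op) (B : Fin 2 → Vec) (V U : Op) : Prop :=
  let R : Fin 2 → Vec := fun i => bloch (ρ i)
  ∃ (U₀ W : Op) (n : Vec), IsUnitary U₀ ∧ IsUnitary W ∧ U = W * U₀ ∧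
    ‖n‖ = 1 ∧ B 0 = ‖B 0‖ • n ∧ B 1 = -(‖B 1‖ • n) ∧
    conjMap W pauliZ = dotPauli n ∧
    ∀ i, bloch (conjMap U₀ (conjMap V (ρ i))) =
      (crossNorm R / minusNorm R * cosTheta R B
        - projR R i / minusNorm R * sinTheta R B) • xAxis +
      (crossNorm R / minusNorm R * sinTheta R B
        + projR R i / minusNorm R * cosTheta R B) • zAxis

/-- `C` is a map `M ↦ U V M V† U†` as prescribed by procedure B. -/
def IsProcedureB (ρ : Fin 2 → Op) (B : Fin 2 → Vec) (C : Op →ₗ[ℂ] Op) : Prop :=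
  ∃ V U : Op, IsStepOne ρ V ∧
    (crossNorm B ≠ 0 → IsRotationGeneric ρ B V U) ∧
    (crossNorm B = 0 → IsRotationAntiparallel ρ B V U) ∧
    C = conjMap (U * V)

end QubitTracking

end

open QubitTracking

/-!
Why the two procedures are optimal. For Hermitian `M`, `N` the trace of `M N` is
`(tr M tr N + bloch M · bloch N) / 2`, so the figure of merit of a channel is
`1/2 + (c₀ · B₀ + c₁ · B₁) / 2` with `cᵢ` the Bloch vectors of the outputs (`merit_eq`).

*Upper bound.* Positivity and trace preservation make a channel contract the quantity
`max |tr M| ‖bloch M‖` (`IsCPTP.norm_bloch_le`). On the span of the two source states this says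
that the form `(x + y)² - ‖x c₀ + y c₁‖²` is at least the minimum of zero and
`(x + y)² - ‖x R₀ + y R₁‖²`. An S-lemma (`exists_form_le`) replaces the minimum by one multiplier
`l ∈ [0, 1]`: as quadratic forms, the Gram matrix of `c` is at most `1 - l (1 - Rᵢ · Rⱼ)`. Since
`(∑ cᵢ · Bᵢ)² ≤ ∑ (cᵢ · cⱼ)(Bᵢ · Bⱼ) + 2 ‖c₀ × c₁‖ ‖B₀ × B₁‖` (`sum_inner_mul_sq_le`) and the right
side is monotone in the Gram matrix of `c`, the problem becomes the maximization over `l` of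
`R̄₊² - l T + 2 R̄× √(l R₋² - l² (R₋² - R×²))`, which is concave. For `S + T > 0` it is at most
`Γ_a²` for every `l ≥ 0` (`bound_le_gammaA_sq`), and `Ω ≤ 0` says that it is nondecreasing
on `[0, 1]`, with the value `Γ_b²` at `l = 1` (`bound_le_gammaB_sq`).

*Attainment.* The coefficients `kᵢⱼ` come from a polar decomposition: the vectors `∑ⱼ kᵢⱼ Bⱼ` have
the Gram matrix of the vectors `α x + βᵢ R̄× z` (`inner_coeffK`) and satisfy
`∑ᵢ (∑ⱼ kᵢⱼ Bⱼ) · Bᵢ = Γ(α, β)` (`sum_inner_coeffK`). Pairs of vectors with equal Gram matrices are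
related by a unitary (`exists_unitary_of_gram_eq`), so the procedures can be carried out, and
`Γ(α, β)` equals the upper bound. If `R̄× = 0` and `Ω ≤ 0`, the targets are antiparallel
(`inner_eq_neg_of_indicator_nonpos`), and the rotation by `ϑ` attains `Γ_b` (`value_antiparallel`).

*Complete positivity and extremality.* One has `μ₁ = μ₂ μ₃` and `s₁² = (1 - μ₂²)(1 - μ₃²)`, for
which `𝒟` has two explicit Kraus operators (`isCPTP_affineMap`). It takes the two pure states on the line
through the source states to non-orthogonal pure states. A channel with this property is determined
by these two values (`IsCPTP.eq_of_pure`), hence it is extreme.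
-/

noncomputable section

namespace QubitTracking

open scoped ComplexOrder Matrix

/-! ### Bloch vectors of Hermitian matrices -/

lemma bloch_zero_apply (M : Op) : bloch M 0 = (M 0 1).re + (M 1 0).re := by
  simp [bloch, pauliX, Matrix.trace_fin_two, Matrix.vecMul, dotProduct, add_comm]

lemma bloch_one_apply (M : Op) : bloch M 1 = (M 1 0).im - (M 0 1).im := by
  simp [bloch, pauliY, Matrix.trace_fin_two, Matrix.vecMul, dotProduct]
  ring

lemma bloch_two_apply (M : Op) : bloch M 2 = (M 0 0).re - (M 1 1).re := by
  simp [bloch, pauliZ, Matrix.trace_fin_two, Matrix.vecMul, dotProduct]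
  ring

lemma vec_ext {u v : Vec} (h0 : u 0 = v 0) (h1 : u 1 = v 1) (h2 : u 2 = v 2) : u = v := by
  ext i
  fin_cases i <;> assumption

lemma inner_vec (u v : Vec) : inner ℝ u v = u 0 * v 0 + u 1 * v 1 + u 2 * v 2 := by
  simp [PiLp.inner_apply, Fin.sum_univ_three, mul_comm]

lemma norm_sq_vec (u : Vec) : ‖u‖ ^ 2 = u 0 ^ 2 + u 1 ^ 2 + u 2 ^ 2 := by
  rw [← real_inner_self_eq_norm_sq, inner_vec]
  ring

lemma bloch_add (M N : Op) : bloch (M + N) = bloch M + bloch N := by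
  refine vec_ext ?_ ?_ ?_ <;>
    simp only [PiLp.add_apply, bloch_zero_apply, bloch_one_apply, bloch_two_apply,
      Matrix.add_apply, Complex.add_re, Complex.add_im] <;> ring

lemma bloch_smul (c : ℝ) (M : Op) : bloch ((c : ℂ) • M) = c • bloch M := by
  refine vec_ext ?_ ?_ ?_ <;>
    simp only [PiLp.smul_apply, bloch_zero_apply, bloch_one_apply, bloch_two_apply,
      Matrix.smul_apply, smul_eq_mul, Complex.re_ofReal_mul, Complex.im_ofReal_mul] <;> ring

/-- The Hermitian matrix `(t + r · σ) / 2` with trace `t` and Bloch vector `r`. -/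
def ofBloch (t : ℝ) (r : Vec) : Op := (1 / 2 : ℂ) • ((t : ℂ) • (1 : Op) + dotPauli r)

lemma ofBloch_eq (t : ℝ) (r : Vec) : ofBloch t r =
    !![((t + r 2) / 2 : ℂ), (r 0 - Complex.I * r 1) / 2;
      (r 0 + Complex.I * r 1) / 2, (t - r 2) / 2] := by
  ext i j
  fin_cases i <;> fin_cases j <;> simp [ofBloch, dotPauli, pauliX, pauliY, pauliZ] <;> ring

lemma isHermitian_ofBloch (t : ℝ) (r : Vec) : (ofBloch t r).IsHermitian := by
  rw [ofBloch_eq]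
  ext i j
  fin_cases i <;> fin_cases j <;>
    simp [Complex.ext_iff]

lemma trace_ofBloch (t : ℝ) (r : Vec) : (ofBloch t r).trace = t := by
  rw [ofBloch_eq, Matrix.trace_fin_two]
  simp only [Matrix.of_apply, Matrix.cons_val]
  ring

lemma bloch_ofBloch (t : ℝ) (r : Vec) : bloch (ofBloch t r) = r := by
  rw [ofBloch_eq]
  refine vec_ext ?_ ?_ ?_ <;> simp [bloch_zero_apply, bloch_one_apply, bloch_two_apply] <;> ring

lemma hermitian_entries {M : Op} (h : M.IsHermitian) :
    (M 0 0).im = 0 ∧ (M 1 1).im = 0 ∧ (M 1 0).re = (M 0 1).re ∧ (M 1 0).im = -(M 0 1).im := by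
  have h00 := h.apply 0 0
  have h11 := h.apply 1 1
  have h10 := h.apply 1 0
  simp only [Complex.ext_iff, RCLike.star_def, Complex.conj_re, Complex.conj_im] at h00 h11 h10
  refine ⟨by linarith [h00.2], by linarith [h11.2], by linarith [h10.1], by linarith [h10.2]⟩

lemma eq_ofBloch {M : Op} (h : M.IsHermitian) : M = ofBloch M.trace.re (bloch M) := by
  obtain ⟨h0, h1, h2, h3⟩ := hermitian_entries h
  rw [ofBloch_eq]
  ext i j
  fin_cases i <;> fin_cases j <;>
    simp [Complex.ext_iff, bloch_zero_apply, bloch_one_apply, bloch_two_apply,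
      Matrix.trace_fin_two, h0, h1, h2, h3]
  all_goals ring_nf

lemma hermitian_ext {M N : Op} (hM : M.IsHermitian) (hN : N.IsHermitian)
    (ht : M.trace = N.trace) (hb : bloch M = bloch N) : M = N := by
  rw [eq_ofBloch hM, eq_ofBloch hN, ht, hb]

/-- The Hilbert-Schmidt inner product in terms of Bloch vectors. -/
lemma trace_mul_re {M N : Op} (hM : M.IsHermitian) (hN : N.IsHermitian) :
    ((M * N).trace).re = (M.trace.re * N.trace.re + inner ℝ (bloch M) (bloch N)) / 2 := by
  obtain ⟨h0, h1, h2, h3⟩ := hermitian_entries hM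
  obtain ⟨k0, k1, k2, k3⟩ := hermitian_entries hN
  simp [Matrix.trace_fin_two, Matrix.mul_apply, Fin.sum_univ_two, inner_vec,
    bloch_zero_apply, bloch_one_apply, bloch_two_apply, h0, h1, h2, h3, k0, k1, k2, k3]
  ring

lemma norm_bloch_le_of_posSemidef {M : Op} (h : M.PosSemidef) : ‖bloch M‖ ≤ M.trace.re := by
  have ht : 0 ≤ M.trace.re := (Complex.le_def.1 h.trace_nonneg).1
  have hd : 0 ≤ M.det.re := (Complex.le_def.1 h.det_nonneg).1
  obtain ⟨h0, h1, h2, h3⟩ := hermitian_entries h.isHermitian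
  refine abs_le_of_sq_le_sq' ?_ ht |>.2
  rw [norm_sq_vec, bloch_zero_apply, bloch_one_apply, bloch_two_apply]
  rw [Matrix.det_fin_two] at hd
  simp [h0, h1, h2, h3, Matrix.trace_fin_two] at hd ⊢
  nlinarith

lemma posSemidef_ofBloch {t : ℝ} {r : Vec} (h : ‖r‖ ≤ t) : (ofBloch t r).PosSemidef := by
  rcases eq_or_lt_of_le ((norm_nonneg r).trans h) with ht | ht
  · have hr : r = 0 := norm_le_zero_iff.1 (ht ▸ h)
    have : ofBloch t r = 0 := by simp [ofBloch, dotPauli, hr, ← ht]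
    rw [this]
    exact Matrix.PosSemidef.zero
  · -- Cayley-Hamilton: `t M = Mᴴ M + det M`.
    have key : ofBloch t r = ((t⁻¹ : ℝ) : ℂ) • ((ofBloch t r)ᴴ * ofBloch t r +
        (((t ^ 2 - ‖r‖ ^ 2) / 4 : ℝ) : ℂ) • (1 : Op)) := by
      rw [(isHermitian_ofBloch t r).eq, norm_sq_vec, ofBloch_eq]
      have ht' : (t : ℂ) ≠ 0 := by exact_mod_cast ht.ne'
      ext i j
      fin_cases i <;> fin_cases j <;>
        simp <;> field_simp <;> ring_nf <;> simp [Complex.I_sq]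
    rw [key]
    refine Matrix.PosSemidef.smul (Matrix.PosSemidef.add
      (Matrix.posSemidef_conjTranspose_mul_self _) (Matrix.PosSemidef.smul .one ?_)) ?_
    · have : ‖r‖ ^ 2 ≤ t ^ 2 := pow_le_pow_left₀ (norm_nonneg r) h 2
      exact_mod_cast (by linarith : 0 ≤ (t ^ 2 - ‖r‖ ^ 2) / 4)
    · exact_mod_cast (inv_pos.2 ht).le

/-! ### Unitary conjugation as a rotation of Bloch vectors -/

lemma conjMap_apply (W M : Op) : conjMap W M = W * M * Wᴴ := rfl

lemma conjMap_mul (U V : Op) : conjMap (U * V) = conjMap U ∘ₗ conjMap V := by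
  ext1 M
  simp [conjMap_apply, Matrix.mul_assoc]

lemma isHermitian_conjMap (W : Op) {M : Op} (h : M.IsHermitian) : (conjMap W M).IsHermitian :=
  Matrix.isHermitian_mul_mul_conjTranspose W h

lemma IsUnitary.conjTranspose_mul {W : Op} (h : IsUnitary W) : Wᴴ * W = 1 :=
  Matrix.mem_unitaryGroup_iff'.1 h

lemma IsUnitary.mul_conjTranspose {W : Op} (h : IsUnitary W) : W * Wᴴ = 1 :=
  Matrix.mem_unitaryGroup_iff.1 h

lemma IsUnitary.mul {U V : Op} (hU : IsUnitary U) (hV : IsUnitary V) : IsUnitary (U * V) :=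
  Submonoid.mul_mem (Matrix.unitaryGroup (Fin 2) ℂ) hU hV

lemma isUnitary_one : IsUnitary 1 := Submonoid.one_mem (Matrix.unitaryGroup (Fin 2) ℂ)

lemma IsUnitary.conjTranspose {W : Op} (h : IsUnitary W) : IsUnitary Wᴴ := by
  rw [IsUnitary, Matrix.mem_unitaryGroup_iff, Matrix.star_eq_conjTranspose,
    Matrix.conjTranspose_conjTranspose]
  exact h.conjTranspose_mul

lemma IsUnitary.trace_conjMap {W : Op} (h : IsUnitary W) (M : Op) :
    (conjMap W M).trace = M.trace := by
  rw [conjMap_apply, Matrix.trace_mul_comm, ← Matrix.mul_assoc, h.conjTranspose_mul, one_mul]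

lemma IsUnitary.inner_bloch_conjMap {W : Op} (h : IsUnitary W) {M N : Op}
    (hM : M.IsHermitian) (hN : N.IsHermitian) :
    inner ℝ (bloch (conjMap W M)) (bloch (conjMap W N)) = inner ℝ (bloch M) (bloch N) := by
  have h1 := trace_mul_re (isHermitian_conjMap W hM) (isHermitian_conjMap W hN)
  have h2 : conjMap W M * conjMap W N = conjMap W (M * N) := by
    simp only [conjMap_apply]
    calc W * M * Wᴴ * (W * N * Wᴴ) = W * M * (Wᴴ * W) * N * Wᴴ := by simp only [Matrix.mul_assoc]
      _ = _ := by rw [h.conjTranspose_mul]; simp only [Matrix.mul_assoc, Matrix.mul_one]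
  rw [h2, h.trace_conjMap, h.trace_conjMap, h.trace_conjMap, trace_mul_re hM hN] at h1
  linarith

lemma dotPauli_eq (n : Vec) : dotPauli n =
    !![(n 2 : ℂ), n 0 - Complex.I * n 1; n 0 + Complex.I * n 1, -n 2] := by
  ext i j
  fin_cases i <;> fin_cases j <;> simp [dotPauli, pauliX, pauliY, pauliZ] <;> ring

lemma isUnitary_dotPauli {n : Vec} (h : ‖n‖ = 1) : IsUnitary (dotPauli n) := by
  have hn : (n 0 : ℂ) ^ 2 + n 1 ^ 2 + n 2 ^ 2 = 1 := by
    have := norm_sq_vec n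
    rw [h, one_pow] at this
    simpa using congrArg Complex.ofReal this.symm
  rw [IsUnitary, Matrix.mem_unitaryGroup_iff, dotPauli_eq]
  ext i j
  fin_cases i <;> fin_cases j <;>
    simp [Matrix.mul_apply, Fin.sum_univ_two] <;> ring_nf <;> simp [Complex.I_sq] <;>
    linear_combination hn

/-- Conjugation by `n · σ` is the rotation by `π` about `n`. -/
lemma bloch_conjMap_dotPauli {n : Vec} (h : ‖n‖ = 1) (M : Op) :
    bloch (conjMap (dotPauli n) M) = (2 * inner ℝ n (bloch M)) • n - bloch M := by
  have hn := norm_sq_vec n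
  rw [h] at hn
  have e : n 2 ^ 2 = 1 - n 0 ^ 2 - n 1 ^ 2 := by linarith
  refine vec_ext ?_ ?_ ?_ <;>
    simp only [conjMap_apply, dotPauli_eq, PiLp.sub_apply, PiLp.smul_apply, inner_vec,
      bloch_zero_apply, bloch_one_apply, bloch_two_apply, smul_eq_mul] <;>
    simp [Matrix.mul_apply, Fin.sum_univ_two, Matrix.vecMul, Matrix.vecHead, Matrix.vecTail] <;>
    ring_nf <;> rw [e] <;> ring

lemma norm_inv_norm_smul {d : Vec} (hd : d ≠ 0) : ‖‖d‖⁻¹ • d‖ = 1 := by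
  rw [norm_smul, norm_inv, norm_norm, inv_mul_cancel₀ (norm_ne_zero_iff.2 hd)]

lemma exists_unitary_reflection (d : Vec) : ∃ (W : Op) (ε : ℝ), IsUnitary W ∧
    (ε = 1 ∨ ε = -1) ∧ ∀ M, bloch (conjMap W M) = ε • (ℝ ∙ d)ᗮ.reflection (bloch M) := by
  by_cases hd : d = 0
  · refine ⟨1, 1, isUnitary_one, .inl rfl, fun M => ?_⟩
    have : (⊤ : Submodule ℝ Vec).reflection (bloch M) = bloch M :=
      Submodule.reflection_eq_self_iff _ |>.2 Submodule.mem_top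
    simp [conjMap_apply, hd, this]
  · refine ⟨dotPauli (‖d‖⁻¹ • d), -1, isUnitary_dotPauli (norm_inv_norm_smul hd), .inr rfl,
      fun M => ?_⟩
    rw [bloch_conjMap_dotPauli (norm_inv_norm_smul hd), Submodule.reflection_orthogonal_apply,
      Submodule.reflection_singleton_apply, inner_smul_left, smul_smul]
    have : ‖d‖ ≠ 0 := by simpa using hd
    simp only [neg_smul, one_smul, neg_neg, RCLike.ofReal_real_eq_id, id, conj_trivial, two_smul,
      ← add_smul]
    congr 2
    field_simp
    ring

lemma exists_unit_orthogonal (b : Fin 2 → Vec) : ∃ m : Vec, ‖m‖ = 1 ∧ ∀ i, inner ℝ m (b i) = 0 := by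
  have hlt : Module.finrank ℝ (Submodule.span ℝ (Set.range b)) < 3 :=
    (finrank_range_le_card b).trans_lt (by simp)
  have hsum := Submodule.finrank_add_finrank_orthogonal (Submodule.span ℝ (Set.range b))
  rw [finrank_euclideanSpace_fin] at hsum
  obtain ⟨m, hm, hm0⟩ := Submodule.exists_mem_ne_zero_of_ne_bot
    (p := (Submodule.span ℝ (Set.range b))ᗮ) (by
      intro h
      rw [h, finrank_bot] at hsum
      omega)
  refine ⟨‖m‖⁻¹ • m, norm_inv_norm_smul hm0, fun i => ?_⟩
  rw [inner_smul_left, Submodule.inner_left_of_mem_orthogonal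
    (Submodule.subset_span (Set.mem_range_self i)) hm, mul_zero]

/-- Two pairs of vectors with the same Gram matrix are related by the Bloch rotation of a unitary.
Two reflections carry one pair to the other, up to an overall sign which a rotation by `π` about a
common normal of the target pair corrects. -/
lemma exists_unitary_of_gram_eq (a b : Fin 2 → Vec)
    (h : ∀ i j, inner ℝ (a i) (a j) = inner ℝ (b i) (b j)) :
    ∃ W, IsUnitary W ∧ ∀ M i, bloch M = a i → bloch (conjMap W M) = b i := by
  have hn : ∀ i, ‖a i‖ = ‖b i‖ := fun i => by
    rw [← sq_eq_sq₀ (norm_nonneg _) (norm_nonneg _), ← real_inner_self_eq_norm_sq, h,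
      real_inner_self_eq_norm_sq]
  obtain ⟨W₁, ε₁, hW₁, hε₁, hr₁⟩ := exists_unitary_reflection (a 0 - b 0)
  have f0 := Submodule.reflection_sub (hn 0)
  set f := (ℝ ∙ (a 0 - b 0))ᗮ.reflection with hf
  obtain ⟨W₂, ε₂, hW₂, hε₂, hr₂⟩ := exists_unitary_reflection (f (a 1) - b 1)
  have g1 := Submodule.reflection_sub (v := f (a 1)) (w := b 1)
    ((f.norm_map _).trans (hn 1))
  have g0 : (ℝ ∙ (f (a 1) - b 1))ᗮ.reflection (b 0) = b 0 := by
    rw [Submodule.reflection_eq_self_iff, Submodule.mem_orthogonal_singleton_iff_inner_right,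
      inner_sub_left, ← f0, f.inner_map_map, f0, h, sub_self]
  set g := (ℝ ∙ (f (a 1) - b 1))ᗮ.reflection with hg
  have hfg : ∀ i, g (f (a i)) = b i := by
    intro i
    fin_cases i
    · exact (congrArg g f0).trans g0
    · exact g1
  have hW : ∀ M i, bloch M = a i → bloch (conjMap (W₂ * W₁) M) = (ε₂ * ε₁) • b i := by
    intro M i hM
    rw [conjMap_mul, LinearMap.comp_apply, hr₂, hr₁, hM, map_smul, hfg, smul_smul]
  rcases (by rcases hε₁ with rfl | rfl <;> rcases hε₂ with rfl | rfl <;> simp :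
    ε₂ * ε₁ = 1 ∨ ε₂ * ε₁ = -1) with hε | hε
  · refine ⟨W₂ * W₁, hW₂.mul hW₁, fun M i hM => ?_⟩
    rw [hW M i hM, hε, one_smul]
  · obtain ⟨m, hm, hmb⟩ := exists_unit_orthogonal b
    refine ⟨dotPauli m * (W₂ * W₁), (isUnitary_dotPauli hm).mul (hW₂.mul hW₁), fun M i hM => ?_⟩
    rw [conjMap_mul, LinearMap.comp_apply, bloch_conjMap_dotPauli hm, hW M i hM, hε,
      inner_smul_right, hmb]
    simp

/-! ### Completely positive maps -/

lemma IsCPTP.map_posSemidef {C : Op →ₗ[ℂ] Op} (h : IsCPTP C) {M : Op} (hM : M.PosSemidef) :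
    (C M).PosSemidef := by
  have h1 := h.1 1 (M.submatrix Prod.snd Prod.snd) (hM.submatrix _)
  exact h1.submatrix (fun i : Fin 2 => ((0 : Fin 1), i))

lemma IsCPTP.map_isHermitian {C : Op →ₗ[ℂ] Op} (h : IsCPTP C) {M : Op} (hM : M.IsHermitian) :
    (C M).IsHermitian := by
  have h1 := (h.map_posSemidef (posSemidef_ofBloch (le_refl ‖bloch M‖))).isHermitian
  have h2 := (h.map_posSemidef (Matrix.PosSemidef.one (n := Fin 2) (R := ℂ))).isHermitian
  have key : M = ofBloch ‖bloch M‖ (bloch M) +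
      (((M.trace.re - ‖bloch M‖) / 2 : ℝ) : ℂ) • (1 : Op) := by
    conv_lhs => rw [eq_ofBloch hM]
    simp only [ofBloch, Complex.ofReal_div, Complex.ofReal_sub]
    module
  rw [key, map_add, map_smul]
  refine h1.add ?_
  rw [Matrix.IsHermitian, Matrix.conjTranspose_smul, h2.eq, RCLike.star_def, Complex.conj_ofReal]

lemma ofBloch_add (t t' : ℝ) (r r' : Vec) :
    ofBloch (t + t') (r + r') = ofBloch t r + ofBloch t' r' := by
  simp only [ofBloch, dotPauli, PiLp.add_apply, Complex.ofReal_add]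
  module

lemma ofBloch_smul (c t : ℝ) (r : Vec) :
    ofBloch (c * t) (c • r) = (c : ℂ) • ofBloch t r := by
  simp only [ofBloch, dotPauli, PiLp.smul_apply, Complex.ofReal_mul, smul_eq_mul]
  module

/-- Trace-norm contraction: a quantum operation does not increase the larger of `|tr M|` and the
length of the Bloch vector. -/
lemma IsCPTP.norm_bloch_le {C : Op →ₗ[ℂ] Op} (h : IsCPTP C) {M : Op} (hM : M.IsHermitian) :
    ‖bloch (C M)‖ ≤ max |M.trace.re| ‖bloch M‖ := by
  have pos : ∀ (t : ℝ) (r : Vec), ‖r‖ ≤ t → ‖bloch (C (ofBloch t r))‖ ≤ t := fun t r hr => by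
    have := norm_bloch_le_of_posSemidef (h.map_posSemidef (posSemidef_ofBloch hr))
    rwa [h.2, trace_ofBloch, Complex.ofReal_re] at this
  rw [eq_ofBloch hM, trace_ofBloch, bloch_ofBloch, Complex.ofReal_re]
  generalize M.trace.re = t
  generalize bloch M = r
  -- Split `M` into its positive and negative parts.
  rcases le_or_gt ‖r‖ |t| with hr | hr
  · refine le_max_of_le_left ?_
    rcases abs_cases t with ⟨ht, -⟩ | ⟨ht, -⟩
    · rw [ht] at hr ⊢
      exact pos t r hr
    · rw [ht] at hr ⊢
      have := pos (-t) (-r) (by rwa [norm_neg])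
      have e := ofBloch_smul (-1) t r
      rw [neg_one_mul, neg_one_smul] at e
      rwa [e, map_smul, bloch_smul, neg_one_smul, norm_neg] at this
  · refine le_max_of_le_right ?_
    have hr0 : ‖r‖ ≠ 0 := ((abs_nonneg t).trans_lt hr).ne'
    obtain ⟨ht1, ht2⟩ := abs_lt.1 hr
    have hn : ‖‖r‖⁻¹ • r‖ = 1 := norm_inv_norm_smul (norm_ne_zero_iff.1 hr0)
    have e : ofBloch t r = (((‖r‖ + t) / 2 : ℝ) : ℂ) • ofBloch 1 (‖r‖⁻¹ • r) +
        ((-((‖r‖ - t) / 2) : ℝ) : ℂ) • ofBloch 1 (-(‖r‖⁻¹ • r)) := by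
      rw [← ofBloch_smul, ← ofBloch_smul, ← ofBloch_add]
      congr 1
      · ring
      · rw [smul_neg, ← neg_smul, neg_neg, ← add_smul, smul_smul]
        rw [show ((‖r‖ + t) / 2 + (‖r‖ - t) / 2) * ‖r‖⁻¹ = 1 by field_simp; ring, one_smul]
    rw [e, map_add, map_smul, map_smul, bloch_add, bloch_smul, bloch_smul]
    refine (norm_add_le _ _).trans ?_
    rw [norm_smul, norm_smul, Real.norm_eq_abs, Real.norm_eq_abs, abs_neg,
      abs_of_nonneg (by linarith), abs_of_nonneg (by linarith)]
    have p1 := pos 1 (‖r‖⁻¹ • r) hn.le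
    have p2 := pos 1 (-(‖r‖⁻¹ • r)) (by rw [norm_neg, hn])
    nlinarith

lemma isCPTP_of_kraus {C : Op →ₗ[ℂ] Op} (A₁ A₂ : Op)
    (h : ∀ M, C M = A₁ * M * A₁ᴴ + A₂ * M * A₂ᴴ) (htr : ∀ M : Op, (C M).trace = M.trace) :
    IsCPTP C := by
  refine ⟨fun k M hM => ?_, htr⟩
  have key : ∀ A : Op, Matrix.of (fun a b : Fin k × Fin 2 =>
      (A * (Matrix.of fun i j => M (a.1, i) (b.1, j)) * Aᴴ) a.2 b.2) =
      (Matrix.of fun a b : Fin k × Fin 2 => if a.1 = b.1 then A a.2 b.2 else 0) * M *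
      (Matrix.of fun a b : Fin k × Fin 2 => if a.1 = b.1 then A a.2 b.2 else 0)ᴴ := by
    intro A
    ext a b
    simp only [Matrix.of_apply, Matrix.mul_apply, Matrix.conjTranspose_apply,
      Fintype.sum_prod_type]
    simp [apply_ite, Finset.sum_ite_eq, ite_mul, Fin.sum_univ_two]
  have e : amplify k C M = Matrix.of (fun a b : Fin k × Fin 2 =>
        (A₁ * (Matrix.of fun i j => M (a.1, i) (b.1, j)) * A₁ᴴ) a.2 b.2) +
      Matrix.of (fun a b : Fin k × Fin 2 =>
        (A₂ * (Matrix.of fun i j => M (a.1, i) (b.1, j)) * A₂ᴴ) a.2 b.2) := by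
    ext a b
    simp [amplify, h]
  rw [e, key, key]
  exact (hM.mul_mul_conjTranspose_same _).add (hM.mul_mul_conjTranspose_same _)

lemma IsUnitary.isCPTP_conjMap {W : Op} (h : IsUnitary W) : IsCPTP (conjMap W) :=
  isCPTP_of_kraus W 0 (fun M => by simp [conjMap_apply]) h.trace_conjMap

lemma IsCPTP.comp {C D : Op →ₗ[ℂ] Op} (hC : IsCPTP C) (hD : IsCPTP D) : IsCPTP (C ∘ₗ D) :=
  ⟨fun k M hM => hC.1 k (amplify k D M) (hD.1 k M hM), fun M => (hC.2 _).trans (hD.2 M)⟩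

/-- `|φ⟩⟨ψ|`. -/
def ketBra (φ ψ : Fin 2 → ℂ) : Op := Matrix.vecMulVec φ (star ψ)

lemma posSemidef_ketBra (φ : Fin 2 → ℂ) : (ketBra φ φ).PosSemidef :=
  Matrix.posSemidef_vecMulVec_self_star φ

lemma trace_ketBra (φ ψ : Fin 2 → ℂ) : (ketBra φ ψ).trace = star ψ ⬝ᵥ φ := by
  rw [ketBra, Matrix.trace_vecMulVec, dotProduct_comm]

lemma conjMap_ketBra (W : Op) (φ ψ : Fin 2 → ℂ) :
    conjMap W (ketBra φ ψ) = ketBra (W *ᵥ φ) (W *ᵥ ψ) := by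
  rw [conjMap_apply, ketBra, ketBra, Matrix.mul_vecMulVec, Matrix.vecMulVec_mul,
    Matrix.star_mulVec]

/-- A matrix whose columns are proportional to `a` and whose rows are proportional to `b` is a
multiple of `aᵢ bⱼ`. -/
lemma eq_mul_of_cross_eq {Y : Op} {a b : Fin 2 → ℂ} (ha : star a ⬝ᵥ a = 1) (hb : star b ⬝ᵥ b = 1)
    (h1 : ∀ i k j, a i * Y k j = a k * Y i j) (h2 : ∀ i j l, b j * Y i l = b l * Y i j) :
    ∃ c : ℂ, ∀ i j, Y i j = c * (a i * b j) := by
  simp only [dotProduct, Fin.sum_univ_two, Pi.star_apply] at ha hb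
  refine ⟨∑ k, ∑ l, star (a k) * star (b l) * Y k l, fun i j => ?_⟩
  have key : ∀ k l, star (a k) * star (b l) * Y k l * (a i * b j) =
      (star (a k) * a k) * (star (b l) * b l) * Y i j := fun k l => by
    linear_combination (star (a k) * star (b l) * b j) * h1 i k l +
      (star (a k) * star (b l) * a k) * h2 i j l
  simp only [Fin.sum_univ_two]
  linear_combination -key 0 0 - key 0 1 - key 1 0 - key 1 1 +
    (-Y i j * (star (b 0) * b 0 + star (b 1) * b 1)) * ha - Y i j * hb

/-- A block of a positive semidefinite matrix whose diagonal neighbours are pure states is a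
multiple of the corresponding `|ψ₀⟩⟨ψ₁|`: the vectors orthogonal to `ψ₀` in the first block and to
`ψ₁` in the second block are null vectors of the matrix. -/
lemma exists_block_eq_smul_ketBra {N : Matrix (Fin 2 × Fin 2) (Fin 2 × Fin 2) ℂ}
    (hN : N.PosSemidef) {ψ : Fin 2 → Fin 2 → ℂ} (hψ : ∀ a, star (ψ a) ⬝ᵥ ψ a = 1)
    (h : ∀ a i j, N (a, i) (a, j) = ketBra (ψ a) (ψ a) i j) :
    ∃ c : ℂ, ∀ i j, N (0, i) (1, j) = c * ketBra (ψ 0) (ψ 1) i j := by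
  have null : ∀ a b j, ψ a 0 * N (a, 1) (b, j) = ψ a 1 * N (a, 0) (b, j) := by
    intro a b j
    set x : Fin 2 × Fin 2 → ℂ := fun q =>
      if q.1 = a then (if q.2 = 0 then -star (ψ a 1) else star (ψ a 0)) else 0 with hx
    have hx0 : star x ⬝ᵥ (N *ᵥ x) = 0 := by
      simp only [hx, dotProduct, Matrix.mulVec, Fintype.sum_prod_type, Pi.star_apply]
      simp [apply_ite, Fin.sum_univ_two, h, ketBra, Matrix.vecMulVec_apply]
      ring
    have hx1 := congrFun ((hN.dotProduct_mulVec_zero_iff x).1 hx0) (b, j)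
    simp only [hx, dotProduct, Matrix.mulVec, Fintype.sum_prod_type] at hx1
    simp [Fin.sum_univ_two] at hx1
    have hx2 := congrArg star hx1
    simp only [star_add, star_neg, star_mul', hN.isHermitian.apply, star_zero,
      RCLike.star_def, Complex.conj_conj] at hx2
    linear_combination hx2
  have null' : ∀ a b j, star (ψ a 0) * N (b, j) (a, 1) = star (ψ a 1) * N (b, j) (a, 0) := by
    intro a b j
    have := congrArg star (null a b j)
    rwa [star_mul', star_mul', hN.isHermitian.apply, hN.isHermitian.apply] at this
  obtain ⟨c, hc⟩ := eq_mul_of_cross_eq (Y := Matrix.of fun i j => N (0, i) (1, j)) (a := ψ 0)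
    (b := star (ψ 1)) (hψ 0) (by rw [star_star, dotProduct_comm]; exact hψ 1)
    (fun i k j => by
      have := null 0 1 j
      fin_cases i <;> fin_cases k <;> simp [this])
    (fun i j l => by
      have := null' 1 0 i
      simp only [RCLike.star_def] at this
      fin_cases j <;> fin_cases l <;> simp [this])
  exact ⟨c, hc⟩

/-- A quantum operation taking the pure states `φₐ` to the non-orthogonal pure states `ψₐ` takes
`|φ₀⟩⟨φ₁|` to a multiple of `|ψ₀⟩⟨ψ₁|`, and trace preservation determines the multiple. -/
lemma IsCPTP.map_ketBra {C : Op →ₗ[ℂ] Op} (hC : IsCPTP C) {φ ψ : Fin 2 → Fin 2 → ℂ}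
    (hψ : ∀ a, star (ψ a) ⬝ᵥ ψ a = 1) (h : ∀ a, C (ketBra (φ a) (φ a)) = ketBra (ψ a) (ψ a))
    (hne : star (ψ 1) ⬝ᵥ ψ 0 ≠ 0) :
    C (ketBra (φ 0) (φ 1)) =
      ((star (φ 1) ⬝ᵥ φ 0) / (star (ψ 1) ⬝ᵥ ψ 0)) • ketBra (ψ 0) (ψ 1) := by
  have hN := hC.1 2 _ (Matrix.posSemidef_vecMulVec_self_star
    (fun q : Fin 2 × Fin 2 => φ q.1 q.2))
  obtain ⟨c, hc⟩ := exists_block_eq_smul_ketBra hN hψ (fun a i j => congrFun₂ (h a) i j)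
  have hc' : C (ketBra (φ 0) (φ 1)) = c • ketBra (ψ 0) (ψ 1) := by
    ext i j
    exact hc i j
  have ht := congrArg Matrix.trace hc'
  rw [hC.2, Matrix.trace_smul, trace_ketBra, trace_ketBra, smul_eq_mul] at ht
  rw [hc', ht, mul_div_cancel_right₀ _ hne]

/-- A quantum operation is determined by its values at two distinct pure states if these values are
pure and not orthogonal. -/
lemma IsCPTP.eq_of_pure {C C' : Op →ₗ[ℂ] Op} (hC : IsCPTP C) (hC' : IsCPTP C')
    {φ ψ : Fin 2 → Fin 2 → ℂ} (hφ : φ 0 0 * φ 1 1 - φ 0 1 * φ 1 0 ≠ 0)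
    (hψ : ∀ a, star (ψ a) ⬝ᵥ ψ a = 1) (hne : star (ψ 1) ⬝ᵥ ψ 0 ≠ 0)
    (h : ∀ a, C (ketBra (φ a) (φ a)) = ketBra (ψ a) (ψ a))
    (h' : ∀ a, C' (ketBra (φ a) (φ a)) = ketBra (ψ a) (ψ a)) : C = C' := by
  have hne' : star (ψ 0) ⬝ᵥ ψ 1 ≠ 0 := by
    intro h0
    apply hne
    rw [← star_star (star (ψ 1) ⬝ᵥ ψ 0), Matrix.star_dotProduct, h0]
    simp
  have hall : ∀ a b, C (ketBra (φ a) (φ b)) = C' (ketBra (φ a) (φ b)) := by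
    intro a b
    fin_cases a <;> fin_cases b
    · exact (h 0).trans (h' 0).symm
    · exact (hC.map_ketBra hψ h hne).trans (hC'.map_ketBra hψ h' hne).symm
    · exact (hC.map_ketBra (φ := φ ∘ Fin.rev) (ψ := ψ ∘ Fin.rev) (fun a => hψ _)
        (fun a => h _) hne').trans (hC'.map_ketBra (φ := φ ∘ Fin.rev) (ψ := ψ ∘ Fin.rev)
        (fun a => hψ _) (fun a => h' _) hne').symm
    · exact (h 1).trans (h' 1).symm
  set F : Op := Matrix.of fun i a => φ a i with hF
  have hdet : IsUnit F.det := by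
    rw [Matrix.det_fin_two, isUnit_iff_ne_zero]
    intro h0
    apply hφ
    simp only [hF, Matrix.of_apply] at h0
    linear_combination h0
  have hdet' : IsUnit (Fᴴ).det := by
    rw [Matrix.det_conjTranspose]
    exact hdet.star
  ext1 M
  obtain ⟨G, hG⟩ : ∃ G : Op, M = F * G * Fᴴ :=
    ⟨F⁻¹ * M * (Fᴴ)⁻¹, by
      rw [← Matrix.mul_assoc, ← Matrix.mul_assoc, Matrix.mul_nonsing_inv _ hdet, Matrix.one_mul,
        Matrix.mul_assoc, Matrix.nonsing_inv_mul _ hdet', Matrix.mul_one]⟩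
  have hM : M = ∑ a, ∑ b, G a b • ketBra (φ a) (φ b) := by
    rw [hG]
    ext i j
    simp [Matrix.mul_apply, Fin.sum_univ_two, hF, ketBra, Matrix.vecMulVec_apply]
    ring
  simp only [hM, map_sum, map_smul, hall]

/-! ### The trace-norm contraction as a single quadratic inequality -/

section Contraction

variable {E : Type*} [NormedAddCommGroup E] [InnerProductSpace ℝ E]

lemma norm_sq_comb (a b : E) (x y : ℝ) :
    ‖x • a + y • b‖ ^ 2 = x ^ 2 * ‖a‖ ^ 2 + 2 * x * y * inner ℝ a b + y ^ 2 * ‖b‖ ^ 2 := by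
  rw [norm_add_sq_real, inner_smul_left, inner_smul_right, norm_smul, norm_smul, mul_pow, mul_pow,
    Real.norm_eq_abs, Real.norm_eq_abs, sq_abs, sq_abs, conj_trivial]
  ring

lemma inner_lt_one_of_ne {a b : E} (ha : ‖a‖ ≤ 1) (hb : ‖b‖ ≤ 1) (h : a ≠ b) :
    inner ℝ a b < 1 := by
  have h1 : 0 < ‖a - b‖ ^ 2 := by
    have := norm_pos_iff.2 (sub_ne_zero.2 h)
    positivity
  rw [norm_sub_sq_real] at h1
  have := pow_le_one₀ (n := 2) (norm_nonneg a) ha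
  have := pow_le_one₀ (n := 2) (norm_nonneg b) hb
  linarith

lemma exists_nonneg_norm_add_smul_eq_one {v d : E} (hv : ‖v‖ ≤ 1) (hd : d ≠ 0) :
    ∃ u : ℝ, 0 ≤ u ∧ ‖v + u • d‖ = 1 := by
  have hd' : 0 < ‖d‖ := norm_pos_iff.2 hd
  have h2 : (0 : ℝ) ≤ 2 / ‖d‖ := by positivity
  have hcont : ContinuousOn (fun u : ℝ => ‖v + u • d‖) (Set.Icc 0 (2 / ‖d‖)) := by fun_prop
  obtain ⟨u, hu, h⟩ := intermediate_value_Icc h2 hcont (show (1 : ℝ) ∈ _ from ⟨by simpa using hv, by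
    have h3 := norm_sub_norm_le ((2 / ‖d‖) • d) (-v)
    rw [norm_smul, Real.norm_of_nonneg h2, div_mul_cancel₀ _ hd'.ne', norm_neg, sub_neg_eq_add,
      add_comm _ v] at h3
    show 1 ≤ ‖v + (2 / ‖d‖) • d‖
    linarith⟩)
  exact ⟨u, hu.1, h⟩

/-- The case of two pure inputs, in which the form `(x + y)² - ‖x n₀ + y n₁‖²` is a positive
multiple of `x y`. -/
lemma exists_form_le_of_norm_eq_one {n₀ n₁ m₀ m₁ : E} (hn₀ : ‖n₀‖ = 1) (hn₁ : ‖n₁‖ = 1)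
    (hne : n₀ ≠ n₁)
    (h : ∀ x y : ℝ, ‖x • m₀ + y • m₁‖ ≤ max |x + y| ‖x • n₀ + y • n₁‖) :
    ∃ l : ℝ, 0 ≤ l ∧ l ≤ 1 ∧ ∀ x y : ℝ,
      l * ((x + y) ^ 2 - ‖x • n₀ + y • n₁‖ ^ 2) ≤ (x + y) ^ 2 - ‖x • m₀ + y • m₁‖ ^ 2 := by
  have hm₀ : ‖m₀‖ ≤ 1 := by simpa [hn₀] using h 1 0
  have hm₁ : ‖m₁‖ ≤ 1 := by simpa [hn₁] using h 0 1
  have hg : 0 < 1 - inner ℝ n₀ n₁ := sub_pos.2 (inner_lt_one_of_ne hn₀.le hn₁.le hne)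
  have hA : 0 ≤ 1 - ‖m₀‖ ^ 2 := sub_nonneg.2 (pow_le_one₀ (norm_nonneg _) hm₀)
  have hB : 0 ≤ 1 - ‖m₁‖ ^ 2 := sub_nonneg.2 (pow_le_one₀ (norm_nonneg _) hm₁)
  have hh : 0 ≤ 1 - inner ℝ m₀ m₁ := by
    have h1 := real_inner_le_norm m₀ m₁
    have h2 := mul_le_one₀ hm₀ (norm_nonneg m₁) hm₁
    linarith
  have hopp : ∀ x y : ℝ, x * y ≤ 0 → 0 ≤ (1 - ‖m₀‖ ^ 2) * x ^ 2 +
      2 * ((1 - inner ℝ m₀ m₁) - (1 - inner ℝ n₀ n₁)) * (x * y) + (1 - ‖m₁‖ ^ 2) * y ^ 2 := by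
    intro x y hxy
    have e1 := norm_sq_comb n₀ n₁ x y
    rw [hn₀, hn₁] at e1
    have e2 := norm_sq_comb m₀ m₁ x y
    have h1 : |x + y| ≤ ‖x • n₀ + y • n₁‖ := by
      refine abs_le_of_sq_le_sq ?_ (norm_nonneg _)
      rw [e1]
      nlinarith
    have h2 := pow_le_pow_left₀ (norm_nonneg _) ((h x y).trans_eq (max_eq_right h1)) 2
    rw [e1, e2] at h2
    linarith
  simp only [norm_sq_comb, hn₀, hn₁]
  have hform : ∀ l x y : ℝ, 0 ≤ (1 - ‖m₀‖ ^ 2) * x ^ 2 +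
      2 * ((1 - inner ℝ m₀ m₁) - l * (1 - inner ℝ n₀ n₁)) * (x * y) + (1 - ‖m₁‖ ^ 2) * y ^ 2 →
      l * ((x + y) ^ 2 - (x ^ 2 * 1 ^ 2 + 2 * x * y * inner ℝ n₀ n₁ + y ^ 2 * 1 ^ 2)) ≤
      (x + y) ^ 2 - (x ^ 2 * ‖m₀‖ ^ 2 + 2 * x * y * inner ℝ m₀ m₁ + y ^ 2 * ‖m₁‖ ^ 2) :=
    fun l x y hl => by nlinarith
  revert hform hopp hh hg hA hB
  generalize 1 - inner ℝ n₀ n₁ = g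
  generalize 1 - inner ℝ m₀ m₁ = k
  generalize 1 - ‖m₀‖ ^ 2 = A
  generalize 1 - ‖m₁‖ ^ 2 = B
  intro hg hA hB hk hopp hform
  have hAB := Real.sqrt_nonneg (A * B)
  have hkg : k - g ≤ √(A * B) := by
    rcases le_or_gt k g with hlt | hlt
    · linarith
    · refine Real.le_sqrt_of_sq_le ?_
      have hd := discrim_le_zero (a := A) (b := -2 * (k - g)) (c := B) fun t => by
        rcases le_or_gt 0 t with ht | ht
        · have := hopp t (-1) (by linarith)
          nlinarith
        · nlinarith [mul_pos (sub_pos.2 hlt) (neg_pos.2 ht), mul_nonneg hA (mul_self_nonneg t)]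
      rw [discrim] at hd
      nlinarith
  -- The multiplier is the least one for which the discriminant of the difference is nonpositive.
  obtain ⟨l, hl0, hl1, hl⟩ : ∃ l : ℝ, 0 ≤ l ∧ l ≤ 1 ∧ (k - l * g) ^ 2 ≤ A * B := by
    rcases le_or_gt k √(A * B) with hlt | hlt
    · refine ⟨0, le_rfl, zero_le_one, ?_⟩
      rw [zero_mul, sub_zero, ← Real.sq_sqrt (mul_nonneg hA hB)]
      exact pow_le_pow_left₀ hk hlt 2
    · refine ⟨(k - √(A * B)) / g, div_nonneg (by linarith) hg.le, ?_, ?_⟩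
      · rw [div_le_one hg]
        linarith
      · rw [div_mul_cancel₀ _ hg.ne', sub_sub_cancel, Real.sq_sqrt (mul_nonneg hA hB)]
  refine ⟨l, hl0, hl1, fun x y => hform l x y ?_⟩
  rcases eq_or_lt_of_le hA with hA0 | hA0
  · have : k - l * g = 0 := by
      rw [← hA0, zero_mul] at hl
      exact pow_eq_zero_iff two_ne_zero |>.1 (le_antisymm hl (sq_nonneg _))
    rw [this]
    nlinarith [mul_nonneg hB (sq_nonneg y), sq_nonneg x]
  · refine nonneg_of_mul_nonneg_right (b := _) ?_ hA0
    nlinarith [sq_nonneg (A * x + (k - l * g) * y), mul_nonneg (sub_nonneg.2 hl) (sq_nonneg y)]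

/-- An S-lemma: if the pair `c` is obtained from two points `R` of the unit ball by a
trace-norm contraction, then a single multiplier `l ∈ [0, 1]` compares the two quadratic forms. -/
lemma exists_form_le {R c : Fin 2 → E} (hR : ∀ i, ‖R i‖ ≤ 1) (hne : R 0 ≠ R 1)
    (h : ∀ x y : ℝ, ‖x • c 0 + y • c 1‖ ≤ max |x + y| ‖x • R 0 + y • R 1‖) :
    ∃ l : ℝ, 0 ≤ l ∧ l ≤ 1 ∧ ∀ x y : ℝ,
      l * ((x + y) ^ 2 - ‖x • R 0 + y • R 1‖ ^ 2) ≤ (x + y) ^ 2 - ‖x • c 0 + y • c 1‖ ^ 2 := by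
  -- `n₀` and `n₁` are the points where the line through `R 0` and `R 1` meets the unit sphere.
  obtain ⟨u, hu, hu1⟩ := exists_nonneg_norm_add_smul_eq_one (hR 1) (sub_ne_zero.2 hne.symm)
  obtain ⟨w, hw, hw1⟩ := exists_nonneg_norm_add_smul_eq_one (hR 0) (sub_ne_zero.2 hne)
  have hk : 0 < 1 + u + w := by linarith
  obtain ⟨l, hl0, hl1, hl⟩ := exists_form_le_of_norm_eq_one (m₀ := c 0 + w • (c 0 - c 1))
    (m₁ := c 1 + u • (c 1 - c 0)) hw1 hu1 (by
      intro he
      have : (1 + u + w) • (R 0 - R 1) = 0 := by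
        rw [← sub_eq_zero] at he
        rw [← he]
        module
      exact (smul_ne_zero hk.ne' (sub_ne_zero.2 hne)) this) (fun x y => by
      have := h (x * (1 + w) - y * u) (y * (1 + u) - x * w)
      convert this using 2
      · module
      · congr 1
        ring
      · congr 1
        module)
  refine ⟨l, hl0, hl1, fun x y => ?_⟩
  have hxy := hl ((x * (1 + u) + y * u) / (1 + u + w)) ((x * w + y * (1 + w)) / (1 + u + w))
  have e : ∀ a b : E, ((x * (1 + u) + y * u) / (1 + u + w)) • (a + w • (a - b)) +
      ((x * w + y * (1 + w)) / (1 + u + w)) • (b + u • (b - a)) = x • a + y • b := by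
    intro a b
    match_scalars <;> field_simp <;> ring
  have e' : (x * (1 + u) + y * u) / (1 + u + w) + (x * w + y * (1 + w)) / (1 + u + w) = x + y := by
    field_simp
    ring
  rwa [e, e, e'] at hxy

end Contraction

/-! ### The parameters in terms of Gram matrices -/

lemma plusNorm_sq (v : Fin 2 → Vec) : plusNorm v ^ 2 =
    inner ℝ (v 0) (v 0) + 2 * inner ℝ (v 0) (v 1) + inner ℝ (v 1) (v 1) := by
  rw [plusNorm, norm_add_sq_real, real_inner_self_eq_norm_sq, real_inner_self_eq_norm_sq]

lemma minusNorm_sq (v : Fin 2 → Vec) : minusNorm v ^ 2 =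
    inner ℝ (v 0) (v 0) - 2 * inner ℝ (v 0) (v 1) + inner ℝ (v 1) (v 1) := by
  rw [minusNorm, norm_sub_sq_real, real_inner_self_eq_norm_sq, real_inner_self_eq_norm_sq]

lemma crossNorm_sq (v : Fin 2 → Vec) : crossNorm v ^ 2 =
    inner ℝ (v 0) (v 0) * inner ℝ (v 1) (v 1) - inner ℝ (v 0) (v 1) ^ 2 := by
  simp only [crossNorm, norm_sq_vec, inner_vec, cross_apply, Matrix.cons_val]
  ring

lemma plusNorm_nonneg (v : Fin 2 → Vec) : 0 ≤ plusNorm v := norm_nonneg _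
lemma minusNorm_nonneg (v : Fin 2 → Vec) : 0 ≤ minusNorm v := norm_nonneg _
lemma crossNorm_nonneg (v : Fin 2 → Vec) : 0 ≤ crossNorm v := norm_nonneg _
lemma paramS_nonneg (R B : Fin 2 → Vec) : 0 ≤ paramS R B := Real.sqrt_nonneg _

lemma paramT_eq (R B : Fin 2 → Vec) : paramT R B =
    (1 - inner ℝ (R 0) (R 0)) * inner ℝ (B 0) (B 0) +
    2 * (1 - inner ℝ (R 0) (R 1)) * inner ℝ (B 0) (B 1) +
    (1 - inner ℝ (R 1) (R 1)) * inner ℝ (B 1) (B 1) := by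
  simp only [paramT, Fin.sum_univ_two, real_inner_comm (R 0) (R 1), real_inner_comm (B 0) (B 1)]
  ring

lemma projR_zero (R : Fin 2 → Vec) :
    projR R 0 = inner ℝ (R 0) (R 0) - inner ℝ (R 0) (R 1) := by
  rw [projR, inner_sub_right]

lemma projR_one (R : Fin 2 → Vec) :
    projR R 1 = inner ℝ (R 0) (R 1) - inner ℝ (R 1) (R 1) := by
  rw [projR, inner_sub_right, real_inner_comm]

lemma projR_sub (R : Fin 2 → Vec) : projR R 0 - projR R 1 = minusNorm R ^ 2 := by
  rw [projR_zero, projR_one, minusNorm_sq]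
  ring

lemma crossNorm_sq_add (R : Fin 2 → Vec) (i j : Fin 2) :
    crossNorm R ^ 2 + projR R i * projR R j = minusNorm R ^ 2 * inner ℝ (R i) (R j) := by
  rw [crossNorm_sq, minusNorm_sq]
  fin_cases i <;> fin_cases j <;>
    simp only [Fin.zero_eta, Fin.mk_one, projR_zero, projR_one, real_inner_comm (R 0) (R 1)] <;>
    ring

lemma norm_comb_projR_sq (R B : Fin 2 → Vec) :
    ‖projR R 0 • B 0 + projR R 1 • B 1‖ ^ 2 =
      minusNorm R ^ 2 * (plusNorm B ^ 2 - paramT R B) - crossNorm R ^ 2 * plusNorm B ^ 2 := by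
  rw [norm_sq_comb, minusNorm_sq, crossNorm_sq, plusNorm_sq, paramT_eq, projR_zero, projR_one,
    ← real_inner_self_eq_norm_sq, ← real_inner_self_eq_norm_sq]
  ring

lemma sum_inner_mul_sq_le (c B : Fin 2 → Vec) :
    (∑ i, inner ℝ (c i) (B i)) ^ 2 ≤
      inner ℝ (c 0) (c 0) * inner ℝ (B 0) (B 0) +
      2 * inner ℝ (c 0) (c 1) * inner ℝ (B 0) (B 1) +
      inner ℝ (c 1) (c 1) * inner ℝ (B 1) (B 1) + 2 * crossNorm c * crossNorm B := by
  -- The defect is `‖c₀ × B₀ + c₁ × B₁‖²` plus twice that of Cauchy-Schwarz for the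
  -- cross products.
  have hcs := real_inner_le_norm (WithLp.toLp 2 (crossProduct (c 0).ofLp (c 1).ofLp) : Vec)
    (WithLp.toLp 2 (crossProduct (B 0).ofLp (B 1).ofLp) : Vec)
  change _ ≤ crossNorm c * crossNorm B at hcs
  simp only [inner_vec, cross_apply, Matrix.cons_val, Fin.sum_univ_two] at hcs ⊢
  nlinarith [sq_nonneg (c 0 1 * B 0 2 - c 0 2 * B 0 1 + (c 1 1 * B 1 2 - c 1 2 * B 1 1)),
    sq_nonneg (c 0 2 * B 0 0 - c 0 0 * B 0 2 + (c 1 2 * B 1 0 - c 1 0 * B 1 2)),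
    sq_nonneg (c 0 0 * B 0 1 - c 0 1 * B 0 0 + (c 1 0 * B 1 1 - c 1 1 * B 1 0))]

lemma gram_form_nonneg (B : Fin 2 → Vec) {p q r : ℝ}
    (h : ∀ x y : ℝ, 0 ≤ p * x ^ 2 + 2 * q * x * y + r * y ^ 2) :
    0 ≤ p * inner ℝ (B 0) (B 0) + 2 * q * inner ℝ (B 0) (B 1) + r * inner ℝ (B 1) (B 1) := by
  simp only [inner_vec]
  have h0 := h (B 0 0) (B 1 0)
  have h1 := h (B 0 1) (B 1 1)
  have h2 := h (B 0 2) (B 1 2)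
  linarith

/-- The determinant is monotone on positive semidefinite forms `a x² + 2 b x y + c y²`. -/
lemma det_le_det_of_form_le {a b c a' b' c' : ℝ} (ha : 0 ≤ a) (hd : 0 ≤ a * c - b ^ 2)
    (hc : 0 ≤ c)
    (h : ∀ x y : ℝ, 0 ≤ (a' - a) * x ^ 2 + 2 * (b' - b) * x * y + (c' - c) * y ^ 2) :
    a * c - b ^ 2 ≤ a' * c' - b' ^ 2 := by
  have h1 := h 1 0
  have h2 := h 0 1
  have hdet : (b' - b) ^ 2 ≤ (a' - a) * (c' - c) := by
    have := discrim_le_zero (a := a' - a) (b := 2 * (b' - b)) (c := c' - c) fun t => by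
      have := h t 1
      linarith
    rw [discrim] at this
    linarith
  simp at h1 h2
  -- The mixed term of the determinant is nonnegative.
  have hmix : 2 * (b * (b' - b)) ≤ a * (c' - c) + c * (a' - a) := by
    have h3 : (b * (b' - b)) ^ 2 ≤ (a * (c' - c)) * (c * (a' - a)) := by
      calc (b * (b' - b)) ^ 2 = b ^ 2 * (b' - b) ^ 2 := by ring
        _ ≤ (a * c) * ((a' - a) * (c' - c)) :=
          mul_le_mul (by linarith) hdet (sq_nonneg _) (mul_nonneg ha hc)
        _ = _ := by ring
    have h4 : 0 ≤ a * (c' - c) + c * (a' - a) := by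
      have := mul_nonneg ha (sub_nonneg.2 h2)
      have := mul_nonneg hc (sub_nonneg.2 h1)
      linarith
    refine (abs_le_of_sq_le_sq' ?_ h4).2
    nlinarith [sq_nonneg (a * (c' - c) - c * (a' - a))]
  nlinarith

/-! ### The upper bound -/

/-- The bound on the figure of merit, with one free parameter `l`; it is attained by the pair `c`
with Gram matrix `1 - l (1 - Rᵢ · Rⱼ)` that is aligned with `B`. -/
lemma exists_sum_inner_sq_le {R c : Fin 2 → Vec} (B : Fin 2 → Vec) (hR : ∀ i, ‖R i‖ ≤ 1)
    (hne : R 0 ≠ R 1)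
    (h : ∀ x y : ℝ, ‖x • c 0 + y • c 1‖ ≤ max |x + y| ‖x • R 0 + y • R 1‖) :
    ∃ l : ℝ, 0 ≤ l ∧ l ≤ 1 ∧
      0 ≤ l * minusNorm R ^ 2 - l ^ 2 * (minusNorm R ^ 2 - crossNorm R ^ 2) ∧
      (∑ i, inner ℝ (c i) (B i)) ^ 2 ≤ plusNorm B ^ 2 - l * paramT R B + 2 *
        √(l * minusNorm R ^ 2 - l ^ 2 * (minusNorm R ^ 2 - crossNorm R ^ 2)) * crossNorm B := by
  obtain ⟨l, hl0, hl1, hl⟩ := exists_form_le hR hne h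
  simp only [norm_sq_comb] at hl
  simp only [← real_inner_self_eq_norm_sq] at hl
  have hP : ∀ x y : ℝ, 0 ≤
      ((1 - l * (1 - inner ℝ (R 0) (R 0))) - inner ℝ (c 0) (c 0)) * x ^ 2 +
      2 * ((1 - l * (1 - inner ℝ (R 0) (R 1))) - inner ℝ (c 0) (c 1)) * x * y +
      ((1 - l * (1 - inner ℝ (R 1) (R 1))) - inner ℝ (c 1) (c 1)) * y ^ 2 := fun x y => by
    have := hl x y
    linarith
  have hcc := crossNorm_sq c
  have hdet := det_le_det_of_form_le real_inner_self_nonneg (hcc ▸ sq_nonneg _)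
    real_inner_self_nonneg hP
  have e : (1 - l * (1 - inner ℝ (R 0) (R 0))) * (1 - l * (1 - inner ℝ (R 1) (R 1))) -
      (1 - l * (1 - inner ℝ (R 0) (R 1))) ^ 2 =
      l * minusNorm R ^ 2 - l ^ 2 * (minusNorm R ^ 2 - crossNorm R ^ 2) := by
    rw [minusNorm_sq, crossNorm_sq]
    ring
  rw [e, ← hcc] at hdet
  refine ⟨l, hl0, hl1, (sq_nonneg _).trans hdet, (sum_inner_mul_sq_le c B).trans ?_⟩
  have h1 := gram_form_nonneg B hP
  have h2 := mul_le_mul_of_nonneg_right (Real.le_sqrt_of_sq_le hdet) (crossNorm_nonneg B)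
  rw [plusNorm_sq, paramT_eq]
  linarith

/-- The arithmetic-geometric mean inequality with weight `a`. -/
lemma two_mul_sqrt_mul_le {a u X : ℝ} (ha : 0 < a) (hu : 0 ≤ u) {l : ℝ} (hl : 0 ≤ l) :
    2 * √(l * u) * X ≤ l * a + u * X ^ 2 / a := by
  have h1 : √(l * u) = √l * √u := Real.sqrt_mul hl u
  have h2 := Real.sq_sqrt hl
  have h3 := Real.sq_sqrt hu
  have h4 : l * a + u * X ^ 2 / a - 2 * √(l * u) * X = (√l * a - √u * X) ^ 2 / a := by
    rw [h1]
    field_simp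
    linear_combination (-a ^ 2) * h2 - X ^ 2 * h3
  have : 0 ≤ (√l * a - √u * X) ^ 2 / a := by positivity
  linarith

lemma minusNorm_pos {R : Fin 2 → Vec} (hne : R 0 ≠ R 1) : 0 < minusNorm R :=
  norm_pos_iff.2 (sub_ne_zero.2 hne)

/-- The distance from the origin to the line through two points of the unit ball is less than one,
because their midpoint lies in the open ball. -/
lemma crossNorm_lt_minusNorm {R : Fin 2 → Vec} (hR : ∀ i, ‖R i‖ ≤ 1) (hne : R 0 ≠ R 1) :
    crossNorm R < minusNorm R := by
  have hm := minusNorm_pos hne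
  refine lt_of_pow_lt_pow_left₀ 2 hm.le ?_
  have h0 := pow_le_one₀ (n := 2) (norm_nonneg _) (hR 0)
  have h1 := pow_le_one₀ (n := 2) (norm_nonneg _) (hR 1)
  have hm2 : 0 < minusNorm R ^ 2 := by positivity
  have hsum : plusNorm R ^ 2 < 4 := by
    rw [plusNorm_sq, real_inner_self_eq_norm_sq, real_inner_self_eq_norm_sq]
    rw [minusNorm_sq, real_inner_self_eq_norm_sq, real_inner_self_eq_norm_sq] at hm2
    linarith
  have key : 4 * crossNorm R ^ 2 = plusNorm R ^ 2 * minusNorm R ^ 2 -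
      (inner ℝ (R 0) (R 0) - inner ℝ (R 1) (R 1)) ^ 2 := by
    rw [crossNorm_sq, plusNorm_sq, minusNorm_sq]
    ring
  nlinarith [sq_nonneg (inner ℝ (R 0) (R 0) - inner ℝ (R 1) (R 1))]

/-! ### Signs and closed forms of the parameters -/

section Parameters

variable {R B : Fin 2 → Vec}

lemma paramS_sq (hlt : crossNorm R < minusNorm R) : paramS R B ^ 2 =
    paramT R B ^ 2 + 4 * crossNorm B ^ 2 * (minusNorm R ^ 2 - crossNorm R ^ 2) := by
  have : crossNorm R ^ 2 ≤ minusNorm R ^ 2 := pow_le_pow_left₀ (crossNorm_nonneg R) hlt.le 2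
  rw [paramS, Real.sq_sqrt]
  have := mul_nonneg (sq_nonneg (crossNorm B)) (sub_nonneg.2 this)
  nlinarith [sq_nonneg (paramT R B)]

lemma abs_paramT_le (hlt : crossNorm R < minusNorm R) : |paramT R B| ≤ paramS R B := by
  have : crossNorm R ^ 2 ≤ minusNorm R ^ 2 := pow_le_pow_left₀ (crossNorm_nonneg R) hlt.le 2
  refine Real.abs_le_sqrt ?_
  have := mul_nonneg (sq_nonneg (crossNorm B)) (sub_nonneg.2 this)
  linarith

lemma paramT_eq_neg_of_plusNorm_eq_zero (h : plusNorm B = 0) :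
    paramT R B = -(minusNorm R ^ 2 * ‖B 0‖ ^ 2) ∧ crossNorm B = 0 := by
  have hB : B 1 = -B 0 := by
    rw [plusNorm, norm_eq_zero] at h
    exact (neg_eq_of_add_eq_zero_right h).symm
  constructor
  · rw [paramT_eq, minusNorm_sq, hB, inner_neg_neg, inner_neg_right,
      ← real_inner_self_eq_norm_sq (B 0)]
    ring
  · rw [← sq_eq_zero_iff, crossNorm_sq, hB, inner_neg_neg, inner_neg_right]
    ring

lemma crossNorm_mul_lt (hΩ : 0 < QubitTracking.indicator R B) :
    2 * crossNorm B * crossNorm R < paramS R B + paramT R B := by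
  rw [QubitTracking.indicator] at hΩ
  linarith

lemma paramS_add_paramT_pos (hΩ : 0 < QubitTracking.indicator R B) :
    0 < paramS R B + paramT R B := by
  have := crossNorm_mul_lt hΩ
  have := mul_nonneg (crossNorm_nonneg B) (crossNorm_nonneg R)
  linarith

lemma paramS_pos (hlt : crossNorm R < minusNorm R) (hΩ : 0 < QubitTracking.indicator R B) :
    0 < paramS R B := by
  have h1 := paramS_add_paramT_pos hΩ
  have h2 := le_abs_self (paramT R B)
  have h3 := abs_paramT_le (B := B) hlt
  linarith

lemma gammaA_sq (h : 0 < paramS R B + paramT R B) : gammaA R B ^ 2 =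
    plusNorm B ^ 2 + 2 * minusNorm R ^ 2 * crossNorm B ^ 2 / (paramS R B + paramT R B) := by
  rw [gammaA, Real.sq_sqrt]
  positivity

lemma gammaA_pos (hlt : crossNorm R < minusNorm R) (hΩ : 0 < QubitTracking.indicator R B) :
    0 < gammaA R B := by
  have hST := paramS_add_paramT_pos hΩ
  rw [gammaA, Real.sqrt_pos]
  have hnn : 0 ≤ 2 * minusNorm R ^ 2 * crossNorm B ^ 2 / (paramS R B + paramT R B) := by positivity
  rcases eq_or_lt_of_le (plusNorm_nonneg B) with h0 | h0
  · obtain ⟨hT, hX⟩ := paramT_eq_neg_of_plusNorm_eq_zero (R := R) h0.symm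
    have hS := paramS_sq (B := B) hlt
    rw [hX] at hS
    have hT0 : paramT R B ≤ 0 := by
      rw [hT, neg_nonpos]
      positivity
    nlinarith
  · positivity

lemma gamma_alphaA_betaA (hlt : crossNorm R < minusNorm R)
    (hΩ : 0 < QubitTracking.indicator R B) :
    QubitTracking.gamma B (alphaA R B) (betaA R B) = gammaA R B := by
  have hST := paramS_add_paramT_pos hΩ
  have hS := paramS_pos hlt hΩ
  have hS2 := paramS_sq (B := B) hlt
  have hα : alphaA R B ^ 2 = (paramS R B + paramT R B) / (2 * paramS R B) :=
    Real.sq_sqrt (by positivity)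
  have hν := Real.sq_sqrt (show 0 ≤ 2 / (paramS R B * (paramS R B + paramT R B)) by positivity)
  have hαν : alphaA R B * √(2 / (paramS R B * (paramS R B + paramT R B))) = 1 / paramS R B := by
    rw [alphaA, ← Real.sqrt_mul (by positivity),
      ← Real.sqrt_sq (by positivity : 0 ≤ 1 / paramS R B)]
    congr 1
    field_simp
  have hpr := projR_sub R
  have hn : ‖betaA R B 0 • B 0 + betaA R B 1 • B 1‖ ^ 2 =
      2 / (paramS R B * (paramS R B + paramT R B)) *
      (minusNorm R ^ 2 * (plusNorm B ^ 2 - paramT R B) - crossNorm R ^ 2 * plusNorm B ^ 2) := by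
    rw [← norm_comb_projR_sq, ← hν, betaA, betaA, mul_smul, mul_smul, ← smul_add, norm_smul,
      mul_pow, Real.norm_eq_abs, sq_abs]
  have hβ : 2 * alphaA R B * (betaA R B 0 - betaA R B 1) =
      2 * (1 / paramS R B) * minusNorm R ^ 2 := by
    rw [betaA, betaA, ← hαν, ← hpr]
    ring
  rw [QubitTracking.gamma, gammaA, hn, hβ, hα]
  congr 1
  field_simp
  linear_combination (-plusNorm B ^ 2) * hS2

lemma gammaB_radicand_nonneg (h0 : 0 < minusNorm R) : 0 ≤ plusNorm B ^ 2 - paramT R B := by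
  have h := norm_comb_projR_sq R B
  have h1 : 0 ≤ minusNorm R ^ 2 * (plusNorm B ^ 2 - paramT R B) := by
    have : 0 ≤ crossNorm R ^ 2 * plusNorm B ^ 2 := by positivity
    nlinarith [sq_nonneg ‖projR R 0 • B 0 + projR R 1 • B 1‖]
  exact nonneg_of_mul_nonneg_right h1 (by positivity)

lemma gammaB_sq (h0 : 0 < minusNorm R) : gammaB R B ^ 2 =
    plusNorm B ^ 2 - paramT R B + 2 * crossNorm R * crossNorm B := by
  rw [gammaB, Real.sq_sqrt]
  have := gammaB_radicand_nonneg (B := B) h0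
  have := mul_nonneg (crossNorm_nonneg R) (crossNorm_nonneg B)
  linarith

lemma crossNorm_source_pos (hlt : crossNorm R < minusNorm R)
    (hΩ : QubitTracking.indicator R B ≤ 0) (hX : crossNorm B ≠ 0) : 0 < crossNorm R := by
  have hX' : 0 < crossNorm B := lt_of_le_of_ne (crossNorm_nonneg B) hX.symm
  have hD : crossNorm R ^ 2 < minusNorm R ^ 2 :=
    pow_lt_pow_left₀ hlt (crossNorm_nonneg R) two_ne_zero
  have hS := paramS_sq (B := B) hlt
  have h1 : 0 < 4 * crossNorm B ^ 2 * (minusNorm R ^ 2 - crossNorm R ^ 2) :=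
    mul_pos (by positivity) (by linarith)
  have h2 : -paramT R B < paramS R B := by
    refine (abs_lt_of_sq_lt_sq' (a := paramT R B) ?_ (paramS_nonneg R B)).1 |> neg_lt.1
    linarith
  rw [QubitTracking.indicator] at hΩ
  by_contra hle
  have h0 : crossNorm R = 0 := le_antisymm (not_lt.1 hle) (crossNorm_nonneg R)
  rw [h0] at hΩ
  linarith

lemma gammaB_pos (h0 : 0 < minusNorm R) (hlt : crossNorm R < minusNorm R)
    (hΩ : QubitTracking.indicator R B ≤ 0) (hX : crossNorm B ≠ 0) : 0 < gammaB R B := by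
  have hX' : 0 < crossNorm B := lt_of_le_of_ne (crossNorm_nonneg B) hX.symm
  rw [gammaB, Real.sqrt_pos]
  have := gammaB_radicand_nonneg (B := B) h0
  have := mul_pos (crossNorm_source_pos hlt hΩ hX) hX'
  linarith

lemma gamma_alphaB_betaB (h0 : 0 < minusNorm R) (hX : crossNorm B ≠ 0) :
    QubitTracking.gamma B (alphaB R) (betaB R B) = gammaB R B := by
  have hpr := projR_sub R
  have hn : ‖betaB R B 0 • B 0 + betaB R B 1 • B 1‖ ^ 2 = (1 / (crossNorm B * minusNorm R)) ^ 2 *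
      (minusNorm R ^ 2 * (plusNorm B ^ 2 - paramT R B) - crossNorm R ^ 2 * plusNorm B ^ 2) := by
    rw [← norm_comb_projR_sq, betaB, betaB, div_eq_mul_one_div, div_eq_mul_one_div (projR R 1),
      mul_comm, mul_comm (projR R 1), mul_smul, mul_smul, ← smul_add, norm_smul, mul_pow,
      Real.norm_eq_abs, sq_abs]
  have hβ : 2 * alphaB R * (betaB R B 0 - betaB R B 1) = 2 * crossNorm R / crossNorm B := by
    rw [betaB, betaB, ← sub_div, hpr, alphaB]
    field_simp
  rw [QubitTracking.gamma, gammaB, hn, hβ, alphaB]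
  congr 1
  field_simp
  ring

/-! ### Maximizing over the multiplier -/

lemma bound_le_gammaA_sq (hlt : crossNorm R < minusNorm R)
    (hST : 0 < paramS R B + paramT R B) {l : ℝ} (hl : 0 ≤ l)
    (hrad : 0 ≤ l * minusNorm R ^ 2 - l ^ 2 * (minusNorm R ^ 2 - crossNorm R ^ 2)) :
    plusNorm B ^ 2 - l * paramT R B + 2 *
      √(l * minusNorm R ^ 2 - l ^ 2 * (minusNorm R ^ 2 - crossNorm R ^ 2)) * crossNorm B ≤
      gammaA R B ^ 2 := by
  have hS2 := paramS_sq (B := B) hlt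
  have e : l * minusNorm R ^ 2 - l ^ 2 * (minusNorm R ^ 2 - crossNorm R ^ 2) =
      l * (minusNorm R ^ 2 - l * (minusNorm R ^ 2 - crossNorm R ^ 2)) := by ring
  rw [e] at hrad ⊢
  have hu : 0 ≤ minusNorm R ^ 2 - l * (minusNorm R ^ 2 - crossNorm R ^ 2) := by
    rcases eq_or_lt_of_le hl with h0 | h0
    · rw [← h0, zero_mul, sub_zero]
      positivity
    · exact nonneg_of_mul_nonneg_right hrad h0
  have h1 := two_mul_sqrt_mul_le (X := crossNorm B) (half_pos hST) hu hl
  rw [gammaA_sq hST]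
  refine (add_le_add_right h1 _).trans_eq ?_
  field_simp
  linear_combination l * hS2

lemma bound_le_gammaB_sq (h0 : 0 < minusNorm R) (hlt : crossNorm R < minusNorm R)
    (hΩ : QubitTracking.indicator R B ≤ 0) {l : ℝ} (hl : 0 ≤ l) (hl1 : l ≤ 1) :
    plusNorm B ^ 2 - l * paramT R B + 2 *
      √(l * minusNorm R ^ 2 - l ^ 2 * (minusNorm R ^ 2 - crossNorm R ^ 2)) * crossNorm B ≤
      gammaB R B ^ 2 := by
  have hS2 := paramS_sq (B := B) hlt
  have hTS := abs_le.1 (abs_paramT_le (B := B) hlt)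
  rw [gammaB_sq h0]
  by_cases hX : crossNorm B = 0
  · rw [QubitTracking.indicator, hX] at hΩ
    have hT : paramT R B ≤ 0 := by
      rw [hX] at hS2
      nlinarith
    rw [hX]
    nlinarith
  have hX' : 0 < crossNorm B := lt_of_le_of_ne (crossNorm_nonneg B) (Ne.symm hX)
  have hR := crossNorm_source_pos hlt hΩ hX
  have hD : crossNorm R ^ 2 < minusNorm R ^ 2 :=
    pow_lt_pow_left₀ hlt (crossNorm_nonneg R) two_ne_zero
  have e : l * minusNorm R ^ 2 - l ^ 2 * (minusNorm R ^ 2 - crossNorm R ^ 2) =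
      l * (minusNorm R ^ 2 - l * (minusNorm R ^ 2 - crossNorm R ^ 2)) := by ring
  have hu : 0 ≤ minusNorm R ^ 2 - l * (minusNorm R ^ 2 - crossNorm R ^ 2) := by
    nlinarith [sq_nonneg (crossNorm R)]
  -- This weight makes the estimate an equality at `l = 1`.
  have ha : 0 < crossNorm R * crossNorm B := mul_pos hR hX'
  have h1 := two_mul_sqrt_mul_le (X := crossNorm B) ha hu hl
  rw [e]
  have h2 : (minusNorm R ^ 2 - l * (minusNorm R ^ 2 - crossNorm R ^ 2)) * crossNorm B ^ 2 /
      (crossNorm R * crossNorm B) = (minusNorm R ^ 2 - l * (minusNorm R ^ 2 - crossNorm R ^ 2)) *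
      crossNorm B / crossNorm R := by
    field_simp
  rw [h2] at h1
  have hslope : 0 ≤ -paramT R B + crossNorm R * crossNorm B -
      (minusNorm R ^ 2 - crossNorm R ^ 2) * crossNorm B / crossNorm R := by
    -- Up to a positive factor the slope is `a² - T a - R̄×² (R₋² - R×²)` at `a = R× R̄×`,
    -- and `Ω ≤ 0` puts `a` above the larger root `(T + S) / 2`.
    have ha2 : (paramS R B + paramT R B) / 2 ≤ crossNorm R * crossNorm B := by
      rw [QubitTracking.indicator] at hΩ
      linarith
    have hq : 0 ≤ (crossNorm R * crossNorm B) ^ 2 - paramT R B * (crossNorm R * crossNorm B) -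
        crossNorm B ^ 2 * (minusNorm R ^ 2 - crossNorm R ^ 2) := by
      have h3 : 0 ≤ (crossNorm R * crossNorm B - (paramS R B + paramT R B) / 2) *
          (crossNorm R * crossNorm B - (paramT R B - paramS R B) / 2) :=
        mul_nonneg (by linarith) (by linarith [paramS_nonneg R B])
      nlinarith
    have h4 : -paramT R B + crossNorm R * crossNorm B -
      (minusNorm R ^ 2 - crossNorm R ^ 2) * crossNorm B / crossNorm R =
      ((crossNorm R * crossNorm B) ^ 2 - paramT R B * (crossNorm R * crossNorm B) -
        crossNorm B ^ 2 * (minusNorm R ^ 2 - crossNorm R ^ 2)) / (crossNorm R * crossNorm B) := by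
      field_simp
      ring
    rw [h4]
    positivity
  have h5 : (minusNorm R ^ 2 - l * (minusNorm R ^ 2 - crossNorm R ^ 2)) * crossNorm B / crossNorm R
      = crossNorm R * crossNorm B + (1 - l) *
        ((minusNorm R ^ 2 - crossNorm R ^ 2) * crossNorm B / crossNorm R) := by
    field_simp
    ring
  rw [h5] at h1
  nlinarith [mul_nonneg (sub_nonneg.2 hl1) hslope]

end Parameters

/-! ### The figure of merit -/

lemma IsDensity.norm_bloch_le {ρ : Op} (h : IsDensity ρ) : ‖bloch ρ‖ ≤ 1 := by
  have := norm_bloch_le_of_posSemidef h.1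
  rwa [h.2, Complex.one_re] at this

lemma bloch_ne_of_ne {ρ ρ' : Op} (h : IsDensity ρ) (h' : IsDensity ρ') (hne : ρ ≠ ρ') :
    bloch ρ ≠ bloch ρ' := fun hb =>
  hne (hermitian_ext h.1.isHermitian h'.1.isHermitian (h.2.trans h'.2.symm) hb)

lemma merit_eq {ρ ρb : Fin 2 → Op} {p : Fin 2 → ℝ} (hρ : ∀ i, IsDensity (ρ i))
    (hρb : ∀ i, IsDensity (ρb i)) (hp : p 0 + p 1 = 1) {C : Op →ₗ[ℂ] Op} (hC : IsCPTP C) :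
    merit ρ ρb p C =
      1 / 2 + (∑ i, inner ℝ (bloch (C (ρ i))) (bloch ((p i : ℂ) • ρb i))) / 2 := by
  simp only [merit, trace_mul_re (hC.map_isHermitian (hρ _).1.isHermitian) (hρb _).1.isHermitian,
    hC.2, (hρ _).2, (hρb _).2, Complex.one_re, bloch_smul, inner_smul_right, Fin.sum_univ_two]
  linear_combination hp / 2

lemma IsCPTP.norm_comb_bloch_le {C : Op →ₗ[ℂ] Op} (hC : IsCPTP C) {ρ : Fin 2 → Op}
    (hρ : ∀ i, IsDensity (ρ i)) (x y : ℝ) :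
    ‖x • bloch (C (ρ 0)) + y • bloch (C (ρ 1))‖ ≤
      max |x + y| ‖x • bloch (ρ 0) + y • bloch (ρ 1)‖ := by
  have hsmul : ∀ (c : ℝ) i, ((c : ℂ) • ρ i).IsHermitian := fun c i => by
    rw [Matrix.IsHermitian, Matrix.conjTranspose_smul, (hρ i).1.isHermitian.eq, RCLike.star_def,
      Complex.conj_ofReal]
  have h := hC.norm_bloch_le ((hsmul x 0).add (hsmul y 1))
  simpa only [map_add, map_smul, bloch_add, bloch_smul, Matrix.trace_add, Matrix.trace_smul,
    (hρ _).2, smul_eq_mul, mul_one, ← Complex.ofReal_add, Complex.ofReal_re] using h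

lemma sum_inner_le_gammaA {ρ : Fin 2 → Op} (B : Fin 2 → Vec) (hρ : ∀ i, IsDensity (ρ i))
    (hne : ρ 0 ≠ ρ 1) (hΩ : 0 < QubitTracking.indicator (fun i => bloch (ρ i)) B)
    {C : Op →ₗ[ℂ] Op} (hC : IsCPTP C) :
    ∑ i, inner ℝ (bloch (C (ρ i))) (B i) ≤ gammaA (fun i => bloch (ρ i)) B := by
  have hR := fun i => (hρ i).norm_bloch_le
  have hne' := bloch_ne_of_ne (hρ 0) (hρ 1) hne
  obtain ⟨l, hl, -, hrad, h⟩ := exists_sum_inner_sq_le (R := fun i => bloch (ρ i))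
    (c := fun i => bloch (C (ρ i))) B hR hne' (hC.norm_comb_bloch_le hρ)
  exact (abs_le_of_sq_le_sq' (h.trans (bound_le_gammaA_sq (crossNorm_lt_minusNorm hR hne')
    (paramS_add_paramT_pos hΩ) hl hrad)) (Real.sqrt_nonneg _)).2

lemma sum_inner_le_gammaB {ρ : Fin 2 → Op} (B : Fin 2 → Vec) (hρ : ∀ i, IsDensity (ρ i))
    (hne : ρ 0 ≠ ρ 1) (hΩ : QubitTracking.indicator (fun i => bloch (ρ i)) B ≤ 0)
    {C : Op →ₗ[ℂ] Op} (hC : IsCPTP C) :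
    ∑ i, inner ℝ (bloch (C (ρ i))) (B i) ≤ gammaB (fun i => bloch (ρ i)) B := by
  have hR := fun i => (hρ i).norm_bloch_le
  have hne' := bloch_ne_of_ne (hρ 0) (hρ 1) hne
  obtain ⟨l, hl, hl1, -, h⟩ := exists_sum_inner_sq_le (R := fun i => bloch (ρ i))
    (c := fun i => bloch (C (ρ i))) B hR hne' (hC.norm_comb_bloch_le hρ)
  exact (abs_le_of_sq_le_sq' (h.trans (bound_le_gammaB_sq (minusNorm_pos hne')
    (crossNorm_lt_minusNorm hR hne') hΩ hl hl1)) (Real.sqrt_nonneg _)).2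

lemma isOptimal_of_sum_inner_eq {ρ ρb : Fin 2 → Op} {p : Fin 2 → ℝ} (hρ : ∀ i, IsDensity (ρ i))
    (hρb : ∀ i, IsDensity (ρb i)) (hp : p 0 + p 1 = 1) {C : Op →ₗ[ℂ] Op} (hC : IsCPTP C) {G : ℝ}
    (heq : ∑ i, inner ℝ (bloch (C (ρ i))) (bloch ((p i : ℂ) • ρb i)) = G)
    (hle : ∀ C' : Op →ₗ[ℂ] Op, IsCPTP C' →
      ∑ i, inner ℝ (bloch (C' (ρ i))) (bloch ((p i : ℂ) • ρb i)) ≤ G) :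
    IsOptimal ρ ρb p C ∧ merit ρ ρb p C = 1 / 2 + G / 2 := by
  refine ⟨⟨hC, fun C' hC' => ?_⟩, by rw [merit_eq hρ hρb hp hC, heq]⟩
  rw [merit_eq hρ hρb hp hC, merit_eq hρ hρb hp hC', heq]
  linarith [hle C' hC']

/-! ### The rotation into the plane of the targets -/

lemma gamma_sq {B : Fin 2 → Vec} {α : ℝ} {β : Fin 2 → ℝ} (h : 0 < QubitTracking.gamma B α β) :
    QubitTracking.gamma B α β ^ 2 = α ^ 2 * plusNorm B ^ 2 +
      (‖β 0 • B 0 + β 1 • B 1‖ ^ 2 + 2 * α * (β 0 - β 1)) * crossNorm B ^ 2 := by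
  rw [QubitTracking.gamma] at h ⊢
  exact Real.sq_sqrt (Real.sqrt_pos.1 h).le

lemma sum_inner_coeffK {B : Fin 2 → Vec} {α : ℝ} {β : Fin 2 → ℝ}
    (h : 0 < QubitTracking.gamma B α β) :
    ∑ i, inner ℝ (∑ j, coeffK B α β i j • B j) (B i) = QubitTracking.gamma B α β := by
  have hsq := gamma_sq h
  rw [norm_sq_comb, plusNorm_sq, ← real_inner_self_eq_norm_sq, ← real_inner_self_eq_norm_sq] at hsq
  have hX := crossNorm_sq B
  simp only [Fin.sum_univ_two, inner_add_left, inner_smul_left, conj_trivial, coeffK,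
    real_inner_comm (B 0) (B 1), Fin.rev_zero, show Fin.rev (1 : Fin 2) = 0 from rfl,
    show Fin.last 1 = (1 : Fin 2) from rfl, Fin.val_zero, Fin.val_one]
  generalize QubitTracking.gamma B α β = g at *
  field_simp
  rw [hsq, hX]
  ring

/-- The vectors `∑ⱼ kᵢⱼ Bⱼ` have the Gram matrix of the vectors `α x + βᵢ ‖B₀ × B₁‖ z`: the matrix
`k` is the positive square root that appears in the polar decomposition. -/
lemma inner_coeffK {B : Fin 2 → Vec} {α : ℝ} {β : Fin 2 → ℝ}
    (h : 0 < QubitTracking.gamma B α β) (i i' : Fin 2) :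
    inner ℝ (∑ j, coeffK B α β i j • B j) (∑ j, coeffK B α β i' j • B j) =
      α ^ 2 + β i * β i' * crossNorm B ^ 2 := by
  have hsq := gamma_sq h
  rw [norm_sq_comb, plusNorm_sq, ← real_inner_self_eq_norm_sq, ← real_inner_self_eq_norm_sq] at hsq
  have hX := crossNorm_sq B
  fin_cases i <;> fin_cases i' <;>
  · simp only [Fin.sum_univ_two, inner_add_left, inner_add_right, inner_smul_left,
      inner_smul_right, conj_trivial, coeffK, Fin.zero_eta, Fin.mk_one,
      real_inner_comm (B 0) (B 1), Fin.rev_zero, show Fin.rev (1 : Fin 2) = 0 from rfl,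
      show Fin.last 1 = (1 : Fin 2) from rfl, Fin.val_zero, Fin.val_one]
    generalize QubitTracking.gamma B α β = g at *
    field_simp
    rw [hsq, hX]
    ring

lemma inner_axes (a b c d : ℝ) :
    inner ℝ (a • xAxis + b • zAxis) (c • xAxis + d • zAxis) = a * c + b * d := by
  simp [inner_vec, xAxis, zAxis]

/-! ### The channel of procedure A -/

lemma affineMap_apply (m₁ m₂ m₃ s : ℝ) {M : Op} (hM : M.IsHermitian) :
    affineMap m₁ m₂ m₃ s M =
      ofBloch M.trace.re !₂[m₁ * bloch M 0 + M.trace.re * s, m₂ * bloch M 1, m₃ * bloch M 2] := by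
  obtain ⟨h0, h1, h2, h3⟩ := hermitian_entries hM
  rw [ofBloch_eq]
  ext i j
  fin_cases i <;> fin_cases j <;>
    simp [affineMap, pauliX, pauliY, pauliZ, Matrix.trace_fin_two, Complex.ext_iff,
      Matrix.vecMul, dotProduct,
      bloch_zero_apply, bloch_one_apply, bloch_two_apply, h0, h1, h2, h3]
  all_goals first | ring1 | (constructor <;> ring1)

/-- With `c₂, s₂` and `c₃, s₃` the cosines and sines of the half angles `u / 2` and `v / 2`, this is
the extreme channel with multipliers `cos u cos v`, `cos u`, `cos v` and shift `sin u sin v`; it has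
two Kraus operators. -/
lemma isCPTP_affineMap {c₂ s₂ c₃ s₃ : ℝ} (h₂ : c₂ ^ 2 + s₂ ^ 2 = 1) (h₃ : c₃ ^ 2 + s₃ ^ 2 = 1) :
    IsCPTP (affineMap ((c₂ ^ 2 - s₂ ^ 2) * (c₃ ^ 2 - s₃ ^ 2)) (c₂ ^ 2 - s₂ ^ 2) (c₃ ^ 2 - s₃ ^ 2)
      ((2 * c₂ * s₂) * (2 * c₃ * s₃))) := by
  have h₂' : (c₂ : ℂ) ^ 2 + s₂ ^ 2 = 1 := by exact_mod_cast congrArg Complex.ofReal h₂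
  have h₃' : (c₃ : ℂ) ^ 2 + s₃ ^ 2 = 1 := by exact_mod_cast congrArg Complex.ofReal h₃
  refine isCPTP_of_kraus (((c₃ * c₂ : ℝ) : ℂ) • 1 + ((s₃ * s₂ : ℝ) : ℂ) • pauliX)
    (((s₃ * c₂ : ℝ) : ℂ) • pauliY + (Complex.I * ((c₃ * s₂ : ℝ) : ℂ)) • pauliZ)
    (fun M => ?_) (fun M => ?_)
  · have e2 : (c₂ : ℂ) ^ 2 = 1 - s₂ ^ 2 := by linear_combination h₂'
    have e3 : (c₃ : ℂ) ^ 2 = 1 - s₃ ^ 2 := by linear_combination h₃'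
    ext i j
    fin_cases i <;> fin_cases j <;>
      simp [affineMap, pauliX, pauliY, pauliZ, Matrix.trace_fin_two, Matrix.mul_apply,
        Matrix.vecMul, dotProduct, Fin.sum_univ_two]
    all_goals
      ring_nf
      simp only [Complex.I_sq, e2, e3]
      ring
  · simp [affineMap, pauliX, pauliY, pauliZ, Matrix.trace_fin_two, Matrix.vecMul, dotProduct]
    ring

/-! ### The parameters of procedure A -/

section ParametersA

variable {R B : Fin 2 → Vec}

lemma mu₁_eq_mul (hlt : crossNorm R < minusNorm R) (hΩ : 0 < QubitTracking.indicator R B) :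
    mu₁ R B = mu₂ R B * mu₃ R B := by
  have hST := paramS_add_paramT_pos hΩ
  have hS := paramS_pos hlt hΩ
  have h : √(2 / (paramS R B * (paramS R B + paramT R B) ^ 3)) =
      √(2 / (paramS R B * (paramS R B + paramT R B))) / (paramS R B + paramT R B) := by
    rw [show 2 / (paramS R B * (paramS R B + paramT R B) ^ 3) =
        2 / (paramS R B * (paramS R B + paramT R B)) / (paramS R B + paramT R B) ^ 2 by field_simp,
      Real.sqrt_div (by positivity), Real.sqrt_sq hST.le]
  rw [mu₁, mu₂, mu₃, h]
  field_simp

lemma one_sub_mu₂_sq (hΩ : 0 < QubitTracking.indicator R B) : 1 - mu₂ R B ^ 2 =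
    ((paramS R B + paramT R B) ^ 2 - 4 * crossNorm B ^ 2 * crossNorm R ^ 2) /
      (paramS R B + paramT R B) ^ 2 := by
  have hST := paramS_add_paramT_pos hΩ
  rw [mu₂]
  field_simp
  ring

lemma mu₃_sq (hlt : crossNorm R < minusNorm R) (hΩ : 0 < QubitTracking.indicator R B) :
    mu₃ R B ^ 2 = 2 / (paramS R B * (paramS R B + paramT R B)) *
      (crossNorm B ^ 2 * minusNorm R ^ 2) := by
  have hST := paramS_add_paramT_pos hΩ
  have hS := paramS_pos hlt hΩ
  rw [mu₃, mul_pow, mul_pow, Real.sq_sqrt (by positivity)]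
  ring

lemma one_sub_mu₃_sq (hlt : crossNorm R < minusNorm R) (hΩ : 0 < QubitTracking.indicator R B) :
    1 - mu₃ R B ^ 2 =
      ((paramS R B + paramT R B) ^ 2 - 4 * crossNorm B ^ 2 * crossNorm R ^ 2) /
        (2 * paramS R B * (paramS R B + paramT R B)) := by
  have hST := paramS_add_paramT_pos hΩ
  have hS := paramS_pos hlt hΩ
  have hS2 := paramS_sq (B := B) hlt
  rw [mu₃_sq hlt hΩ]
  field_simp
  linear_combination hS2

lemma defect_pos (hΩ : 0 < QubitTracking.indicator R B) :
    0 < (paramS R B + paramT R B) ^ 2 - 4 * crossNorm B ^ 2 * crossNorm R ^ 2 := by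
  have h := crossNorm_mul_lt hΩ
  have h0 := mul_nonneg (crossNorm_nonneg B) (crossNorm_nonneg R)
  have := pow_lt_pow_left₀ h (by linarith) two_ne_zero
  nlinarith

lemma mu₂_mem (hΩ : 0 < QubitTracking.indicator R B) : 0 ≤ mu₂ R B ∧ mu₂ R B < 1 := by
  have hST := paramS_add_paramT_pos hΩ
  have hX := crossNorm_nonneg B
  have hR := crossNorm_nonneg R
  have h := crossNorm_mul_lt hΩ
  refine ⟨by rw [mu₂]; positivity, ?_⟩
  rw [mu₂, div_mul_eq_mul_div, div_mul_eq_mul_div, div_lt_one hST]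
  exact h

lemma mu₃_mem (hlt : crossNorm R < minusNorm R) (hΩ : 0 < QubitTracking.indicator R B) :
    0 ≤ mu₃ R B ∧ mu₃ R B < 1 := by
  have hST := paramS_add_paramT_pos hΩ
  have hS := paramS_pos hlt hΩ
  have hX := crossNorm_nonneg B
  have hR := minusNorm_nonneg R
  refine ⟨by rw [mu₃]; positivity, ?_⟩
  have h : 0 < 1 - mu₃ R B ^ 2 := by
    rw [one_sub_mu₃_sq hlt hΩ]
    exact div_pos (defect_pos hΩ) (by positivity)
  exact (abs_lt_of_sq_lt_sq' (by linarith) zero_le_one).2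

lemma mu₁_mem (hlt : crossNorm R < minusNorm R) (hΩ : 0 < QubitTracking.indicator R B) :
    mu₁ R B ∈ Set.Icc 0 1 := by
  obtain ⟨h1, h2⟩ := mu₂_mem hΩ
  obtain ⟨h3, h4⟩ := mu₃_mem hlt hΩ
  rw [mu₁_eq_mul hlt hΩ]
  exact ⟨mul_nonneg h1 h3, mul_le_one₀ h2.le h3 h4.le⟩

lemma shift_pos (hlt : crossNorm R < minusNorm R) (hΩ : 0 < QubitTracking.indicator R B) :
    0 < shift R B := by
  have hST := paramS_add_paramT_pos hΩ
  have hS := paramS_pos hlt hΩ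
  have := defect_pos hΩ
  rw [shift]
  positivity

lemma shift_eq (hlt : crossNorm R < minusNorm R) (hΩ : 0 < QubitTracking.indicator R B) :
    shift R B = √(1 - mu₂ R B ^ 2) * √(1 - mu₃ R B ^ 2) := by
  have hST := paramS_add_paramT_pos hΩ
  have hS := paramS_pos hlt hΩ
  have hd := defect_pos hΩ
  rw [one_sub_mu₂_sq hΩ, one_sub_mu₃_sq hlt hΩ, ← Real.sqrt_mul (by positivity), shift,
    ← Real.sqrt_sq hd.le, ← Real.sqrt_mul (by positivity), Real.sqrt_sq hd.le]
  congr 1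
  field_simp

lemma mu₁_add_shift (h0 : 0 < minusNorm R) (hlt : crossNorm R < minusNorm R)
    (hΩ : 0 < QubitTracking.indicator R B) :
    mu₁ R B * (crossNorm R / minusNorm R) + shift R B = alphaA R B := by
  have hST := paramS_add_paramT_pos hΩ
  have hS := paramS_pos hlt hΩ
  have h1 : √(2 / (paramS R B * (paramS R B + paramT R B) ^ 3)) =
      2 * √(1 / (2 * paramS R B * (paramS R B + paramT R B) ^ 3)) := by
    rw [← Real.sqrt_sq (zero_le_two (α := ℝ)), ← Real.sqrt_mul (by positivity),
      Real.sqrt_sq (zero_le_two (α := ℝ))]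
    congr 1
    field_simp
  have h2 : alphaA R B = √(1 / (2 * paramS R B * (paramS R B + paramT R B) ^ 3)) *
      (paramS R B + paramT R B) ^ 2 := by
    rw [alphaA, show (paramS R B + paramT R B) / (2 * paramS R B) =
        1 / (2 * paramS R B * (paramS R B + paramT R B) ^ 3) *
        ((paramS R B + paramT R B) ^ 2) ^ 2 by field_simp,
      Real.sqrt_mul (by positivity), Real.sqrt_sq (sq_nonneg _)]
  rw [h2, mu₁, h1, shift]
  field_simp
  ring

lemma alphaA_pos (hlt : crossNorm R < minusNorm R) (hΩ : 0 < QubitTracking.indicator R B) :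
    0 < alphaA R B := by
  have hST := paramS_add_paramT_pos hΩ
  have hS := paramS_pos hlt hΩ
  rw [alphaA]
  positivity

lemma mu₃_mul_projR (h0 : 0 < minusNorm R) (i : Fin 2) :
    mu₃ R B * (projR R i / minusNorm R) = betaA R B i * crossNorm B := by
  rw [mu₃, betaA]
  field_simp

/-- `𝒟` takes the two pure states with `x`-component `R× / R₋` to pure states with `x`-component
`α`. -/
lemma alphaA_sq_add (h0 : 0 < minusNorm R) (hlt : crossNorm R < minusNorm R)
    (hΩ : 0 < QubitTracking.indicator R B) :
    alphaA R B ^ 2 + mu₃ R B ^ 2 * (1 - (crossNorm R / minusNorm R) ^ 2) = 1 := by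
  have hST := paramS_add_paramT_pos hΩ
  have hS := paramS_pos hlt hΩ
  have hS2 := paramS_sq (B := B) hlt
  rw [alphaA, Real.sq_sqrt (by positivity), mu₃_sq hlt hΩ]
  field_simp
  linear_combination -hS2

lemma isCPTP_channelD (hlt : crossNorm R < minusNorm R) (hΩ : 0 < QubitTracking.indicator R B) :
    IsCPTP (channelD R B) := by
  obtain ⟨h1, h2⟩ := mu₂_mem hΩ
  obtain ⟨h3, h4⟩ := mu₃_mem hlt hΩ
  have key : ∀ m : ℝ, 0 ≤ m → m < 1 → √((1 + m) / 2) ^ 2 + √((1 - m) / 2) ^ 2 = 1 ∧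
      √((1 + m) / 2) ^ 2 - √((1 - m) / 2) ^ 2 = m ∧
      2 * √((1 + m) / 2) * √((1 - m) / 2) = √(1 - m ^ 2) := by
    intro m hm hm'
    rw [Real.sq_sqrt (by linarith), Real.sq_sqrt (by linarith), mul_assoc,
      ← Real.sqrt_mul (by linarith)]
    refine ⟨by ring, by ring, ?_⟩
    rw [← Real.sqrt_sq (zero_le_two (α := ℝ)), ← Real.sqrt_mul (by positivity),
      Real.sqrt_sq (zero_le_two (α := ℝ))]
    congr 1
    ring
  obtain ⟨k1, k2, k3⟩ := key _ h1 h2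
  obtain ⟨l1, l2, l3⟩ := key _ h3 h4
  have h := isCPTP_affineMap k1 l1
  rwa [k2, l2, k3, l3, ← mu₁_eq_mul hlt hΩ, ← shift_eq hlt hΩ] at h

lemma bloch_channelD {M : Op} (hM : M.IsHermitian) (ht : M.trace = 1) {x z : ℝ}
    (hb : bloch M = x • xAxis + z • zAxis) :
    bloch (channelD R B M) = (mu₁ R B * x + shift R B) • xAxis + (mu₃ R B * z) • zAxis := by
  rw [channelD, affineMap_apply _ _ _ _ hM, bloch_ofBloch, hb, ht]
  refine vec_ext ?_ ?_ ?_ <;> simp [xAxis, zAxis]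

end ParametersA

/-! ### Extreme quantum operations -/

lemma bloch_real_smul (c : ℝ) (M : Op) : bloch (c • M) = c • bloch M := by
  rw [← bloch_smul, Complex.coe_smul]

lemma isDensity_ketBra {ψ : Fin 2 → ℂ} (hψ : star ψ ⬝ᵥ ψ = 1) : IsDensity (ketBra ψ ψ) :=
  ⟨posSemidef_ketBra ψ, (trace_ketBra ψ ψ).trans hψ⟩

lemma norm_bloch_ketBra {ψ : Fin 2 → ℂ} (hψ : star ψ ⬝ᵥ ψ = 1) : ‖bloch (ketBra ψ ψ)‖ = 1 := by
  have hd := isDensity_ketBra hψ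
  have h := trace_mul_re hd.1.isHermitian hd.1.isHermitian
  have hsq : ketBra ψ ψ * ketBra ψ ψ = ketBra ψ ψ := by
    simp only [ketBra]
    rw [Matrix.vecMulVec_mul_vecMulVec, hψ]
    simp
  rw [hsq, hd.2, Complex.one_re, real_inner_self_eq_norm_sq] at h
  have h2 : ‖bloch (ketBra ψ ψ)‖ ^ 2 = 1 := by linarith
  exact (pow_eq_one_iff_of_nonneg (norm_nonneg _) two_ne_zero).1 h2

/-- Pure states are extreme among the density matrices. -/
lemma eq_ketBra_of_comb {ψ : Fin 2 → ℂ} (hψ : star ψ ⬝ᵥ ψ = 1) {σ σ' : Op} (hσ : IsDensity σ)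
    (hσ' : IsDensity σ') {a b : ℝ} (ha : 0 < a) (hb : 0 < b) (hab : a + b = 1)
    (h : a • σ + b • σ' = ketBra ψ ψ) : σ = ketBra ψ ψ := by
  have hd := isDensity_ketBra hψ
  have hn := norm_bloch_ketBra hψ
  refine hermitian_ext hσ.1.isHermitian hd.1.isHermitian (hσ.2.trans hd.2.symm) ?_
  have hc := congrArg (fun M => inner ℝ (bloch M) (bloch (ketBra ψ ψ))) h
  simp only [bloch_add, bloch_real_smul, inner_add_left, inner_smul_left, conj_trivial,
    real_inner_self_eq_norm_sq, hn] at hc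
  have h1 := real_inner_le_norm (bloch σ) (bloch (ketBra ψ ψ))
  have h2 := real_inner_le_norm (bloch σ') (bloch (ketBra ψ ψ))
  rw [hn, mul_one] at h1 h2
  have h3 := hσ.norm_bloch_le
  have h4 := hσ'.norm_bloch_le
  have h5 : 1 ≤ inner ℝ (bloch σ) (bloch (ketBra ψ ψ)) := by nlinarith
  have h6 : ‖bloch σ - bloch (ketBra ψ ψ)‖ ^ 2 ≤ 0 := by
    rw [norm_sub_sq_real, hn]
    have := pow_le_one₀ (n := 2) (norm_nonneg _) h3
    linarith
  rw [← sub_eq_zero, ← norm_eq_zero]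
  exact pow_eq_zero_iff two_ne_zero |>.1 (le_antisymm h6 (sq_nonneg _))

lemma IsCPTP.map_isDensity {C : Op →ₗ[ℂ] Op} (hC : IsCPTP C) {σ : Op} (hσ : IsDensity σ) :
    IsDensity (C σ) := ⟨hC.map_posSemidef hσ.1, (hC.2 σ).trans hσ.2⟩

/-- A quantum operation which takes two distinct pure states to non-orthogonal pure states is
extreme: the operations of a convex decomposition have the same values at the two states. -/
lemma IsCPTP.mem_extremePoints {C : Op →ₗ[ℂ] Op} (hC : IsCPTP C) {φ ψ : Fin 2 → Fin 2 → ℂ}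
    (hφ : φ 0 0 * φ 1 1 - φ 0 1 * φ 1 0 ≠ 0) (hφ1 : ∀ a, star (φ a) ⬝ᵥ φ a = 1)
    (hψ : ∀ a, star (ψ a) ⬝ᵥ ψ a = 1) (hne : star (ψ 1) ⬝ᵥ ψ 0 ≠ 0)
    (h : ∀ a, C (ketBra (φ a) (φ a)) = ketBra (ψ a) (ψ a)) :
    C ∈ Set.extremePoints ℝ {C' : Op →ₗ[ℂ] Op | IsCPTP C'} := by
  refine ⟨hC, fun C₁ hC₁ C₂ hC₂ ⟨a, b, ha, hb, hab, hseg⟩ => ?_⟩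
  refine IsCPTP.eq_of_pure hC₁ hC hφ hψ hne (fun i => ?_) h
  refine eq_ketBra_of_comb (hψ i) (IsCPTP.map_isDensity hC₁ (isDensity_ketBra (hφ1 i)))
    (IsCPTP.map_isDensity hC₂ (isDensity_ketBra (hφ1 i))) ha hb hab ?_
  rw [← h i, ← hseg]
  rfl

/-- The spinor of the pure state in the `xz`-plane with `z`-component `z` and nonnegative
`x`-component. -/
def spinor (z : ℝ) : Fin 2 → ℂ := ![(√((1 + z) / 2) : ℝ), (√((1 - z) / 2) : ℝ)]

lemma sqrt_half_mul {z : ℝ} (h1 : -1 ≤ z) :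
    √((1 + z) / 2) * √((1 - z) / 2) = √(1 - z ^ 2) / 2 := by
  rw [← Real.sqrt_mul (by linarith), show (1 + z) / 2 * ((1 - z) / 2) = (1 - z ^ 2) / 2 ^ 2 by ring,
    Real.sqrt_div' _ (by positivity), Real.sqrt_sq zero_le_two]

lemma star_spinor_dotProduct (z w : ℝ) : star (spinor z) ⬝ᵥ spinor w =
    ((√((1 + z) / 2) * √((1 + w) / 2) + √((1 - z) / 2) * √((1 - w) / 2) : ℝ) : ℂ) := by
  simp [spinor, dotProduct, Fin.sum_univ_two]

lemma star_spinor_self {z : ℝ} (h1 : -1 ≤ z) (h2 : z ≤ 1) :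
    star (spinor z) ⬝ᵥ spinor z = 1 := by
  rw [star_spinor_dotProduct, Real.mul_self_sqrt (by linarith), Real.mul_self_sqrt (by linarith)]
  norm_num [← add_div]

lemma star_spinor_neg {z : ℝ} (h1 : -1 ≤ z) :
    star (spinor (-z)) ⬝ᵥ spinor z = (√(1 - z ^ 2) : ℝ) := by
  rw [star_spinor_dotProduct, ← sub_eq_add_neg, sub_neg_eq_add, mul_comm, sqrt_half_mul h1,
    add_halves]

lemma ketBra_spinor {z : ℝ} (h1 : -1 ≤ z) (h2 : z ≤ 1) :
    ketBra (spinor z) (spinor z) = ofBloch 1 (√(1 - z ^ 2) • xAxis + z • zAxis) := by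
  have e1 : (√((1 + z) / 2) : ℂ) * √((1 + z) / 2) = (1 + z) / 2 := by
    exact_mod_cast congrArg Complex.ofReal (Real.mul_self_sqrt (show 0 ≤ (1 + z) / 2 by linarith))
  have e2 : (√((1 - z) / 2) : ℂ) * √((1 - z) / 2) = (1 - z) / 2 := by
    exact_mod_cast congrArg Complex.ofReal (Real.mul_self_sqrt (show 0 ≤ (1 - z) / 2 by linarith))
  have e3 : (√((1 + z) / 2) : ℂ) * √((1 - z) / 2) = √(1 - z ^ 2) / 2 := by
    exact_mod_cast congrArg Complex.ofReal (sqrt_half_mul h1)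
  rw [ofBloch_eq]
  simp only [ketBra, spinor]
  generalize √((1 + z) / 2) = p at *
  generalize √((1 - z) / 2) = q at *
  ext i j
  fin_cases i <;> fin_cases j <;>
    simp [ Matrix.vecMulVec_apply, xAxis, zAxis, e1, e2, e3, mul_comm]

/-! ### Procedure A -/

section ProcedureA

variable {ρ : Fin 2 → Op} {B : Fin 2 → Vec}

lemma exists_isStepOne (h0 : 0 < minusNorm fun i => bloch (ρ i)) : ∃ V, IsStepOne ρ V := by
  set R : Fin 2 → Vec := fun i => bloch (ρ i) with hR
  obtain ⟨V, hV, h⟩ := exists_unitary_of_gram_eq R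
    (fun i => (crossNorm R / minusNorm R) • xAxis + (projR R i / minusNorm R) • zAxis)
    (fun i j => by
      rw [inner_axes]
      have := crossNorm_sq_add R i j
      field_simp
      linear_combination -this)
  exact ⟨V, hV, fun i => h _ i rfl⟩

lemma bloch_channelD_stepOne (hρ : ∀ i, IsDensity (ρ i))
    (h0 : 0 < minusNorm fun i => bloch (ρ i))
    (hlt : (crossNorm fun i => bloch (ρ i)) < minusNorm fun i => bloch (ρ i))
    (hΩ : 0 < QubitTracking.indicator (fun i => bloch (ρ i)) B)
    {V : Op} (hV : IsStepOne ρ V) (i : Fin 2) :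
    bloch (channelD (fun i => bloch (ρ i)) B (conjMap V (ρ i))) =
      alphaA (fun i => bloch (ρ i)) B • xAxis +
        (betaA (fun i => bloch (ρ i)) B i * crossNorm B) • zAxis := by
  rw [bloch_channelD (isHermitian_conjMap V (hρ i).1.isHermitian)
    ((hV.1.trace_conjMap _).trans (hρ i).2) (hV.2 i), mu₁_add_shift h0 hlt hΩ, mu₃_mul_projR h0]

lemma exists_isProcedureA (hρ : ∀ i, IsDensity (ρ i))
    (h0 : 0 < minusNorm fun i => bloch (ρ i))
    (hlt : (crossNorm fun i => bloch (ρ i)) < minusNorm fun i => bloch (ρ i))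
    (hΩ : 0 < QubitTracking.indicator (fun i => bloch (ρ i)) B) :
    ∃ C, IsProcedureA ρ B C := by
  obtain ⟨V, hV⟩ := exists_isStepOne h0
  have hΓ : 0 < QubitTracking.gamma B (alphaA (fun i => bloch (ρ i)) B)
      (betaA (fun i => bloch (ρ i)) B) := by
    rw [gamma_alphaA_betaA hlt hΩ]
    exact gammaA_pos hlt hΩ
  obtain ⟨U, hU, h⟩ := exists_unitary_of_gram_eq
    (fun i => bloch (channelD (fun i => bloch (ρ i)) B (conjMap V (ρ i))))
    (fun i => ∑ j, coeffK B (alphaA (fun i => bloch (ρ i)) B)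
      (betaA (fun i => bloch (ρ i)) B) i j • B j) (fun i j => by
      rw [bloch_channelD_stepOne hρ h0 hlt hΩ hV, bloch_channelD_stepOne hρ h0 hlt hΩ hV,
        inner_axes, inner_coeffK hΓ]
      ring)
  exact ⟨_, V, U, hV, hU, fun i => h _ i rfl, rfl⟩

lemma IsProcedureA.isCPTP (hlt : (crossNorm fun i => bloch (ρ i)) < minusNorm fun i => bloch (ρ i))
    (hΩ : 0 < QubitTracking.indicator (fun i => bloch (ρ i)) B)
    {C : Op →ₗ[ℂ] Op} (hC : IsProcedureA ρ B C) : IsCPTP C := by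
  obtain ⟨V, U, hV, hU, -, rfl⟩ := hC
  exact hU.isCPTP_conjMap.comp ((isCPTP_channelD hlt hΩ).comp hV.1.isCPTP_conjMap)

lemma IsProcedureA.sum_inner_eq
    (hlt : (crossNorm fun i => bloch (ρ i)) < minusNorm fun i => bloch (ρ i))
    (hΩ : 0 < QubitTracking.indicator (fun i => bloch (ρ i)) B)
    {C : Op →ₗ[ℂ] Op} (hC : IsProcedureA ρ B C) :
    ∑ i, inner ℝ (bloch (C (ρ i))) (B i) = gammaA (fun i => bloch (ρ i)) B := by
  obtain ⟨V, U, hV, hU, h, rfl⟩ := hC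
  have hΓ := gamma_alphaA_betaA hlt hΩ
  rw [← hΓ, ← sum_inner_coeffK (hΓ ▸ gammaA_pos hlt hΩ)]
  simp only [LinearMap.comp_apply, h]

lemma star_mulVec_dotProduct {W : Op} (hW : IsUnitary W) (φ ψ : Fin 2 → ℂ) :
    star (W *ᵥ φ) ⬝ᵥ (W *ᵥ ψ) = star φ ⬝ᵥ ψ := by
  rw [Matrix.star_mulVec, Matrix.dotProduct_mulVec, Matrix.vecMul_vecMul, hW.conjTranspose_mul,
    Matrix.vecMul_one]

lemma det_mulVec (W : Op) (φ ψ : Fin 2 → ℂ) :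
    (W *ᵥ φ) 0 * (W *ᵥ ψ) 1 - (W *ᵥ φ) 1 * (W *ᵥ ψ) 0 = W.det * (φ 0 * ψ 1 - φ 1 * ψ 0) := by
  simp only [Matrix.mulVec, dotProduct, Fin.sum_univ_two, Matrix.det_fin_two]
  ring

lemma IsProcedureA.mem_extremePoints (h0 : 0 < minusNorm fun i => bloch (ρ i))
    (hlt : (crossNorm fun i => bloch (ρ i)) < minusNorm fun i => bloch (ρ i))
    (hΩ : 0 < QubitTracking.indicator (fun i => bloch (ρ i)) B)
    {C : Op →ₗ[ℂ] Op} (hC : IsProcedureA ρ B C) :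
    C ∈ Set.extremePoints ℝ {C' : Op →ₗ[ℂ] Op | IsCPTP C'} := by
  have hCP := hC.isCPTP hlt hΩ
  obtain ⟨V, U, hV, hU, -, rfl⟩ := hC
  set R : Fin 2 → Vec := fun i => bloch (ρ i)
  set x := crossNorm R / minusNorm R with hx
  have hx0 : 0 ≤ x := div_nonneg (crossNorm_nonneg R) h0.le
  have hx1 : x < 1 := (div_lt_one h0).2 hlt
  have hα := alphaA_sq_add h0 hlt hΩ
  rw [← hx] at hα
  have hαpos := alphaA_pos hlt hΩ
  obtain ⟨hm0, hm1⟩ := mu₃_mem hlt hΩ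
  have hz2 : 0 < 1 - x ^ 2 := by nlinarith
  set z := √(1 - x ^ 2) with hz
  have hzsq : z ^ 2 = 1 - x ^ 2 := Real.sq_sqrt hz2.le
  have hz0 : 0 < z := Real.sqrt_pos.2 hz2
  have hz1 : z ≤ 1 := by nlinarith
  have hmz : 0 ≤ mu₃ R B * z := mul_nonneg hm0 hz0.le
  have hmz1 : mu₃ R B * z ≤ 1 := mul_le_one₀ hm1.le hz0.le hz1
  have hxz : √(1 - z ^ 2) = x := by rw [hzsq, sub_sub_cancel, Real.sqrt_sq hx0]
  have hαz : √(1 - (mu₃ R B * z) ^ 2) = alphaA R B := by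
    rw [mul_pow, hzsq, ← eq_sub_of_add_eq hα, Real.sqrt_sq hαpos.le]
  -- The pure states of the `xz`-plane on the line through the two source states.
  have hD : ∀ t : ℝ, t = z ∨ t = -z →
      channelD R B (ketBra (spinor t) (spinor t)) =
        ketBra (spinor (mu₃ R B * t)) (spinor (mu₃ R B * t)) := by
    intro t ht
    have hb : -1 ≤ t ∧ t ≤ 1 ∧ -1 ≤ mu₃ R B * t ∧ mu₃ R B * t ≤ 1 ∧ t ^ 2 = z ^ 2 := by
      rcases ht with rfl | rfl
      · exact ⟨by linarith, hz1, by linarith, hmz1, rfl⟩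
      · exact ⟨by linarith, by linarith, by linarith, by linarith, by ring⟩
    obtain ⟨b1, b2, b3, b4, b5⟩ := hb
    have hd := isDensity_ketBra (star_spinor_self b1 b2)
    have hd' := isDensity_ketBra (star_spinor_self b3 b4)
    have hDd := (isCPTP_channelD hlt hΩ).map_isDensity hd
    refine hermitian_ext hDd.1.isHermitian hd'.1.isHermitian (hDd.2.trans hd'.2.symm) ?_
    have hbl : bloch (ketBra (spinor t) (spinor t)) = x • xAxis + t • zAxis := by
      rw [ketBra_spinor b1 b2, bloch_ofBloch, b5, hxz]
    rw [bloch_channelD hd.1.isHermitian hd.2 hbl, ketBra_spinor b3 b4, bloch_ofBloch,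
      mu₁_add_shift h0 hlt hΩ, mul_pow, b5, ← mul_pow, hαz]
  have hsign : ∀ a : Fin 2, (![z, -z] a = z ∨ ![z, -z] a = -z) := by
    intro a
    fin_cases a <;> simp
  refine hCP.mem_extremePoints (φ := fun a => Vᴴ *ᵥ spinor (![z, -z] a))
    (ψ := fun a => U *ᵥ spinor (mu₃ R B * ![z, -z] a)) ?_ (fun a => ?_) (fun a => ?_) ?_
    (fun a => ?_)
  · rw [det_mulVec]
    refine mul_ne_zero ?_ ?_
    · have := congrArg Matrix.det hV.1.conjTranspose_mul
      rw [Matrix.det_mul, Matrix.det_one] at this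
      exact left_ne_zero_of_mul_eq_one this
    · have e1 := Real.mul_self_sqrt (show 0 ≤ (1 + z) / 2 by linarith)
      have e2 := Real.mul_self_sqrt (show 0 ≤ (1 - z) / 2 by linarith)
      have e : spinor (![z, -z] 0) 0 * spinor (![z, -z] 1) 1 -
          spinor (![z, -z] 0) 1 * spinor (![z, -z] 1) 0 = ((√((1 + z) / 2) * √((1 + z) / 2) -
            √((1 - z) / 2) * √((1 - z) / 2) : ℝ) : ℂ) := by
        simp only [spinor, Matrix.cons_val, sub_neg_eq_add, ← sub_eq_add_neg]
        push_cast
        rfl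
      rw [e, e1, e2]
      norm_cast
      linarith
  · rw [star_mulVec_dotProduct hV.1.conjTranspose]
    rcases hsign a with h | h <;> rw [h]
    · exact star_spinor_self (by linarith) hz1
    · exact star_spinor_self (by linarith) (by linarith)
  · rw [star_mulVec_dotProduct hU]
    rcases hsign a with h | h <;> rw [h]
    · exact star_spinor_self (by linarith) hmz1
    · exact star_spinor_self (by linarith) (by linarith)
  · rw [star_mulVec_dotProduct hU]
    simp only [Matrix.cons_val, mul_neg]
    rw [star_spinor_neg (by linarith), hαz]
    exact_mod_cast hαpos.ne'
  · rw [LinearMap.comp_apply, LinearMap.comp_apply, conjMap_ketBra, Matrix.mulVec_mulVec,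
      hV.1.mul_conjTranspose, Matrix.one_mulVec, hD _ (hsign a), conjMap_ketBra]

lemma IsProcedureA.ne_conjMap
    (hlt : (crossNorm fun i => bloch (ρ i)) < minusNorm fun i => bloch (ρ i))
    (hΩ : 0 < QubitTracking.indicator (fun i => bloch (ρ i)) B)
    {C : Op →ₗ[ℂ] Op} (hC : IsProcedureA ρ B C) : ¬ ∃ W, IsUnitary W ∧ C = conjMap W := by
  -- A unitary channel is unital, whereas `𝒟` shifts the maximally mixed state.
  rintro ⟨W, hW, hCW⟩
  obtain ⟨V, U, hV, hU, -, rfl⟩ := hC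
  have h1 := LinearMap.congr_fun hCW 1
  have hone : ∀ {W : Op}, IsUnitary W → conjMap W 1 = 1 := fun hW => by
    rw [conjMap_apply, mul_one, hW.mul_conjTranspose]
  have hherm : (1 : Op).IsHermitian := Matrix.isHermitian_one
  rw [LinearMap.comp_apply, LinearMap.comp_apply, hone hV.1, hone hW] at h1
  have hb1 : bloch (1 : Op) = 0 := by
    refine vec_ext ?_ ?_ ?_ <;> simp [bloch_zero_apply, bloch_one_apply, bloch_two_apply]
  have hDherm : (channelD (fun i => bloch (ρ i)) B 1).IsHermitian :=
    (isCPTP_channelD hlt hΩ).map_isHermitian hherm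
  have h2 := hU.inner_bloch_conjMap hDherm hDherm
  rw [h1, hb1, inner_zero_left, channelD, affineMap_apply _ _ _ _ hherm, bloch_ofBloch, hb1,
    inner_vec] at h2
  have hs := shift_pos hlt hΩ
  simp [Matrix.trace_one] at h2
  exact hs.ne' h2

end ProcedureA

/-! ### Procedure B for antiparallel targets -/

section Antiparallel

variable {R B : Fin 2 → Vec}

lemma paramT_nonpos (hlt : crossNorm R < minusNorm R) (hΩ : QubitTracking.indicator R B ≤ 0)
    (hX : crossNorm B = 0) : paramT R B ≤ 0 := by
  have hS := paramS_sq (B := B) hlt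
  rw [QubitTracking.indicator] at hΩ
  rw [hX] at hS hΩ
  nlinarith [paramS_nonneg R B]

/-- For `R̄× = 0` the condition `Ω ≤ 0` forces the targets to be antiparallel. -/
lemma inner_eq_neg_of_indicator_nonpos (hR : ∀ i, ‖R i‖ ≤ 1) (hne : R 0 ≠ R 1)
    (hΩ : QubitTracking.indicator R B ≤ 0) (hX : crossNorm B = 0) :
    inner ℝ (B 0) (B 1) = -(‖B 0‖ * ‖B 1‖) := by
  have hT := paramT_nonpos (crossNorm_lt_minusNorm hR hne) hΩ hX
  have hc := crossNorm_sq B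
  rw [hX, real_inner_self_eq_norm_sq, real_inner_self_eq_norm_sq] at hc
  have hsq : inner ℝ (B 0) (B 1) ^ 2 = (‖B 0‖ * ‖B 1‖) ^ 2 := by linarith
  rcases sq_eq_sq_iff_eq_or_eq_neg.1 hsq with h | h
  · -- Parallel targets would give `T > 0`.
    rw [paramT_eq, h] at hT
    simp only [real_inner_self_eq_norm_sq] at hT
    have h0 := pow_le_one₀ (n := 2) (norm_nonneg _) (hR 0)
    have h1 := pow_le_one₀ (n := 2) (norm_nonneg _) (hR 1)
    have h01 := inner_lt_one_of_ne (hR 0) (hR 1) hne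
    have hp := mul_nonneg (norm_nonneg (B 0)) (norm_nonneg (B 1))
    have k0 := mul_nonneg (sub_nonneg.2 h0) (sq_nonneg ‖B 0‖)
    have k1 := mul_nonneg (sub_nonneg.2 h1) (sq_nonneg ‖B 1‖)
    have : ‖B 0‖ * ‖B 1‖ = 0 := by nlinarith
    rw [h, this, neg_zero]
  · exact h

lemma exists_antiparallel_direction (h : inner ℝ (B 0) (B 1) = -(‖B 0‖ * ‖B 1‖)) :
    ∃ n : Vec, ‖n‖ = 1 ∧ B 0 = ‖B 0‖ • n ∧ B 1 = -(‖B 1‖ • n) := by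
  have h' : inner ℝ (B 0) (-B 1) = ‖B 0‖ * ‖-B 1‖ := by rw [inner_neg_right, h, norm_neg, neg_neg]
  have hpar := inner_eq_norm_mul_iff_real.1 h'
  rw [norm_neg, smul_neg] at hpar
  by_cases h0 : B 0 = 0
  · by_cases h1 : B 1 = 0
    · refine ⟨zAxis, ?_, by simp [h0], by simp [h1]⟩
      rw [← sq_eq_sq₀ (norm_nonneg _) zero_le_one, norm_sq_vec]
      simp [zAxis]
    · refine ⟨-(‖B 1‖⁻¹ • B 1), by rw [norm_neg, norm_inv_norm_smul h1], by simp [h0], ?_⟩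
      rw [smul_neg, neg_neg, smul_smul, mul_inv_cancel₀ (norm_ne_zero_iff.2 h1), one_smul]
  · have hn0 := norm_ne_zero_iff.2 h0
    refine ⟨‖B 0‖⁻¹ • B 0, norm_inv_norm_smul h0, ?_, ?_⟩
    · rw [smul_smul, mul_inv_cancel₀ hn0, one_smul]
    · rw [smul_comm, hpar, smul_neg, neg_neg, smul_smul, inv_mul_cancel₀ hn0, one_smul]

lemma plusNorm_sq_of_antiparallel (h : inner ℝ (B 0) (B 1) = -(‖B 0‖ * ‖B 1‖)) :
    plusNorm B ^ 2 = (‖B 0‖ - ‖B 1‖) ^ 2 := by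
  rw [plusNorm_sq, h, real_inner_self_eq_norm_sq, real_inner_self_eq_norm_sq]
  ring

lemma minusNorm_sq_mul_of_antiparallel (h : inner ℝ (B 0) (B 1) = -(‖B 0‖ * ‖B 1‖)) :
    minusNorm R ^ 2 * (plusNorm B ^ 2 - paramT R B) =
      (crossNorm R * (‖B 0‖ - ‖B 1‖)) ^ 2 + (projR R 0 * ‖B 0‖ - projR R 1 * ‖B 1‖) ^ 2 := by
  have h1 := norm_comb_projR_sq R B
  rw [norm_sq_comb, h] at h1
  linear_combination -h1 + crossNorm R ^ 2 * plusNorm_sq_of_antiparallel h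

/-- The choice `cos ϑ ≥ 0` is consistent: the `z`-component to be aligned with `n` is
nonnegative. -/
lemma projR_mul_sub_nonneg (hlt : crossNorm R < minusNorm R)
    (hΩ : QubitTracking.indicator R B ≤ 0) (hX : crossNorm B = 0)
    (h01 : inner ℝ (R 0) (R 1) ≤ 1) (h : inner ℝ (B 0) (B 1) = -(‖B 0‖ * ‖B 1‖)) :
    0 ≤ projR R 0 * ‖B 0‖ - projR R 1 * ‖B 1‖ := by
  have hT := paramT_nonpos hlt hΩ hX
  rw [paramT_eq, h, real_inner_self_eq_norm_sq (B 0), real_inner_self_eq_norm_sq (B 1)] at hT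
  have hm := sq_nonneg (minusNorm R)
  rw [minusNorm_sq] at hm
  rw [projR_zero, projR_one]
  have hu := norm_nonneg (B 0)
  have hv := norm_nonneg (B 1)
  generalize ‖B 0‖ = u at *
  generalize ‖B 1‖ = v at *
  generalize inner ℝ (R 0) (R 0) = a at *
  generalize inner ℝ (R 1) (R 1) = b at *
  generalize inner ℝ (R 0) (R 1) = c at *
  rcases eq_or_lt_of_le (add_nonneg hu hv) with h0 | h0
  · have hu0 : u = 0 := by linarith
    have hv0 : v = 0 := by linarith
    simp [hu0, hv0]
  · refine nonneg_of_mul_nonneg_right (b := _) ?_ h0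
    -- With `p = 1 - a`, `q = 1 - b`, `r = 1 - c` one has
    -- `(u + v) (p u + q v) = u v (p + q) + (p u² + q v²) ≤ 4 r u v ≤ r (u + v)²`.
    nlinarith [mul_nonneg (mul_nonneg hu hv) hm, mul_nonneg (sub_nonneg.2 h01) (sq_nonneg (u - v))]

lemma plusNorm_sq_sub_pos (h0 : 0 < minusNorm R) (hlt : crossNorm R < minusNorm R)
    (hΩ : QubitTracking.indicator R B ≤ 0) (hX : crossNorm B = 0) (hB : B ≠ 0) :
    0 < plusNorm B ^ 2 - paramT R B := by
  have hT := paramT_nonpos hlt hΩ hX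
  rcases eq_or_lt_of_le (plusNorm_nonneg B) with hp | hp
  · have hT' := (paramT_eq_neg_of_plusNorm_eq_zero (R := R) hp.symm).1
    have hB0 : B 0 ≠ 0 := by
      intro h
      apply hB
      have hs : B 0 + B 1 = 0 := norm_eq_zero.1 hp.symm
      funext i
      fin_cases i
      · exact h
      · simpa [h] using hs
    have := norm_pos_iff.2 hB0
    rw [hT', ← hp]
    have : 0 < minusNorm R ^ 2 * ‖B 0‖ ^ 2 := by positivity
    linarith
  · have : 0 < plusNorm B ^ 2 := by positivity
    linarith

lemma sinTheta_sq_le_one (h0 : 0 < minusNorm R)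
    (h : inner ℝ (B 0) (B 1) = -(‖B 0‖ * ‖B 1‖)) : sinTheta R B ^ 2 ≤ 1 := by
  rw [sinTheta, div_pow, mul_pow (minusNorm R), Real.sq_sqrt (gammaB_radicand_nonneg h0),
    minusNorm_sq_mul_of_antiparallel h]
  exact div_le_one_of_le₀ (by nlinarith [sq_nonneg (projR R 0 * ‖B 0‖ - projR R 1 * ‖B 1‖)])
    (by positivity)

/-- The rotation by `ϑ` aligns the vector with `x`-component `R× (‖B₀‖ - ‖B₁‖)` and `z`-component
`r₀ ‖B₀‖ - r₁ ‖B₁‖` with the `z`-axis; its length is `R₋ Γ_b`. -/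
lemma value_antiparallel (hR : ∀ i, ‖R i‖ ≤ 1) (hne : R 0 ≠ R 1)
    (hΩ : QubitTracking.indicator R B ≤ 0) (hX : crossNorm B = 0)
    (h : inner ℝ (B 0) (B 1) = -(‖B 0‖ * ‖B 1‖)) :
    (crossNorm R / minusNorm R * sinTheta R B + projR R 0 / minusNorm R * cosTheta R B) * ‖B 0‖ -
    (crossNorm R / minusNorm R * sinTheta R B + projR R 1 / minusNorm R * cosTheta R B) * ‖B 1‖ =
      gammaB R B := by
  have h0 := minusNorm_pos hne
  have hlt := crossNorm_lt_minusNorm hR hne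
  have hG : gammaB R B = √(plusNorm B ^ 2 - paramT R B) := by
    rw [gammaB, hX, mul_zero, add_zero]
  by_cases hB : B = 0
  · rw [hG, paramT_eq, plusNorm_sq]
    simp [hB]
  have hpos := plusNorm_sq_sub_pos h0 hlt hΩ hX hB
  have hw := projR_mul_sub_nonneg hlt hΩ hX (inner_lt_one_of_ne (hR 0) (hR 1) hne).le h
  have hid := minusNorm_sq_mul_of_antiparallel (R := R) h
  have hq : 0 < √(plusNorm B ^ 2 - paramT R B) := Real.sqrt_pos.2 hpos
  have hqsq := Real.sq_sqrt hpos.le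
  rw [← hqsq] at hid
  have hcos : cosTheta R B = (projR R 0 * ‖B 0‖ - projR R 1 * ‖B 1‖) /
      (minusNorm R * √(plusNorm B ^ 2 - paramT R B)) := by
    rw [cosTheta, ← Real.sqrt_sq (div_nonneg hw (mul_pos h0 hq).le)]
    congr 1
    rw [sinTheta]
    field_simp
    linear_combination hid
  rw [hG, hcos, sinTheta]
  field_simp
  linear_combination -hid

lemma bloch_dotPauli (n : Vec) : bloch (dotPauli n) = (2 : ℝ) • n := by
  refine vec_ext ?_ ?_ ?_ <;>
    simp [dotPauli_eq, bloch_zero_apply, bloch_one_apply, bloch_two_apply] <;> ring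

lemma dotPauli_zAxis : dotPauli zAxis = pauliZ := by
  simp [dotPauli, zAxis]

lemma isHermitian_dotPauli (n : Vec) : (dotPauli n).IsHermitian := by
  rw [dotPauli_eq]
  ext i j
  fin_cases i <;> fin_cases j <;> simp [Complex.ext_iff]

end Antiparallel

/-! ### Procedure B -/

section ProcedureB

variable {ρ : Fin 2 → Op} {B : Fin 2 → Vec}

lemma exists_isRotationGeneric (h0 : 0 < minusNorm fun i => bloch (ρ i))
    (hlt : (crossNorm fun i => bloch (ρ i)) < minusNorm fun i => bloch (ρ i))
    (hΩ : QubitTracking.indicator (fun i => bloch (ρ i)) B ≤ 0) (hX : crossNorm B ≠ 0)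
    {V : Op} (hV : IsStepOne ρ V) : ∃ U, IsRotationGeneric ρ B V U := by
  have hΓ : 0 < QubitTracking.gamma B (alphaB fun i => bloch (ρ i))
      (betaB (fun i => bloch (ρ i)) B) := by
    rw [gamma_alphaB_betaB h0 hX]
    exact gammaB_pos h0 hlt hΩ hX
  obtain ⟨U, hU, h⟩ := exists_unitary_of_gram_eq (fun i => bloch (conjMap V (ρ i)))
    (fun i => ∑ j, coeffK B (alphaB fun i => bloch (ρ i))
      (betaB (fun i => bloch (ρ i)) B) i j • B j) (fun i j => by
      rw [hV.2, hV.2, inner_axes, inner_coeffK hΓ, alphaB, betaB, betaB]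
      field_simp)
  exact ⟨U, hU, fun i => h _ i rfl⟩

lemma exists_isRotationAntiparallel (h0 : 0 < minusNorm fun i => bloch (ρ i))
    (hanti : inner ℝ (B 0) (B 1) = -(‖B 0‖ * ‖B 1‖))
    {V : Op} (hV : IsStepOne ρ V) : ∃ U, IsRotationAntiparallel ρ B V U := by
  have hsc : cosTheta (fun i => bloch (ρ i)) B ^ 2 = 1 - sinTheta (fun i => bloch (ρ i)) B ^ 2 :=
    Real.sq_sqrt (sub_nonneg.2 (sinTheta_sq_le_one h0 hanti))
  obtain ⟨n, hn, hB0, hB1⟩ := exists_antiparallel_direction hanti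
  set R : Fin 2 → Vec := fun i => bloch (ρ i) with hR
  obtain ⟨U₀, hU₀, h⟩ := exists_unitary_of_gram_eq (fun i => bloch (conjMap V (ρ i)))
    (fun i => (crossNorm R / minusNorm R * cosTheta R B
        - projR R i / minusNorm R * sinTheta R B) • xAxis +
      (crossNorm R / minusNorm R * sinTheta R B
        + projR R i / minusNorm R * cosTheta R B) • zAxis) (fun i j => by
      rw [hV.2, hV.2, inner_axes, inner_axes]
      linear_combination (-(crossNorm R / minusNorm R) ^ 2 -
        projR R i / minusNorm R * (projR R j / minusNorm R)) * hsc)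
  have hz : ‖zAxis‖ = 1 := by
    rw [← sq_eq_sq₀ (norm_nonneg _) zero_le_one, norm_sq_vec]
    simp [zAxis]
  obtain ⟨W, hW, hWz⟩ := exists_unitary_of_gram_eq (fun _ => (2 : ℝ) • zAxis)
    (fun _ => (2 : ℝ) • n) (fun i j => by
      simp only [inner_smul_left, inner_smul_right, real_inner_self_eq_norm_sq, hn, hz])
  refine ⟨W * U₀, U₀, W, n, hU₀, hW, rfl, hn, hB0, hB1, ?_, fun i => h _ i rfl⟩
  have hZ : pauliZ.IsHermitian := dotPauli_zAxis ▸ isHermitian_dotPauli zAxis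
  refine hermitian_ext (isHermitian_conjMap W hZ) (isHermitian_dotPauli n) ?_ ?_
  · rw [hW.trace_conjMap, dotPauli_eq]
    simp [pauliZ, Matrix.trace_fin_two]
  · rw [hWz _ 0 (by rw [← dotPauli_zAxis, bloch_dotPauli]), bloch_dotPauli]

lemma exists_isProcedureB (hρ : ∀ i, IsDensity (ρ i)) (hne : bloch (ρ 0) ≠ bloch (ρ 1))
    (hΩ : QubitTracking.indicator (fun i => bloch (ρ i)) B ≤ 0) : ∃ C, IsProcedureB ρ B C := by
  have hR := fun i => (hρ i).norm_bloch_le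
  have h0 : 0 < minusNorm fun i => bloch (ρ i) := minusNorm_pos hne
  have hlt : (crossNorm fun i => bloch (ρ i)) < minusNorm fun i => bloch (ρ i) :=
    crossNorm_lt_minusNorm hR hne
  obtain ⟨V, hV⟩ := exists_isStepOne h0
  by_cases hX : crossNorm B = 0
  · obtain ⟨U, hU⟩ := exists_isRotationAntiparallel h0
      (inner_eq_neg_of_indicator_nonpos hR hne hΩ hX) hV
    exact ⟨_, V, U, hV, fun h => absurd hX h, fun _ => hU, rfl⟩
  · obtain ⟨U, hU⟩ := exists_isRotationGeneric h0 hlt hΩ hX hV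
    exact ⟨_, V, U, hV, fun _ => hU, fun h => absurd h hX, rfl⟩

lemma IsProcedureB.exists_unitary {C : Op →ₗ[ℂ] Op} (hC : IsProcedureB ρ B C) :
    ∃ W, IsUnitary W ∧ C = conjMap W := by
  obtain ⟨V, U, hV, h1, h2, rfl⟩ := hC
  refine ⟨U * V, ?_, rfl⟩
  by_cases hX : crossNorm B = 0
  · obtain ⟨U₀, W, n, hU₀, hW, rfl, -⟩ := h2 hX
    exact (hW.mul hU₀).mul hV.1
  · exact (h1 hX).1.mul hV.1

lemma IsRotationAntiparallel.sum_inner_eq (hρ : ∀ i, IsDensity (ρ i))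
    (hne : bloch (ρ 0) ≠ bloch (ρ 1))
    (hΩ : QubitTracking.indicator (fun i => bloch (ρ i)) B ≤ 0) (hX : crossNorm B = 0)
    {V U : Op} (h : IsRotationAntiparallel ρ B V U) :
    ∑ i, inner ℝ (bloch (conjMap U (conjMap V (ρ i)))) (B i) =
      gammaB (fun i => bloch (ρ i)) B := by
  have hR := fun i => (hρ i).norm_bloch_le
  obtain ⟨U₀, W, n, hU₀, hW, rfl, hn, hB0, hB1, hWz, hU⟩ := h
  have hanti := inner_eq_neg_of_indicator_nonpos hR hne hΩ hX
  rw [← value_antiparallel hR hne hΩ hX hanti]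
  have hZ : pauliZ.IsHermitian := dotPauli_zAxis ▸ isHermitian_dotPauli zAxis
  -- The component of an output along `n` is the `z`-component before the rotation `W`.
  have key : ∀ i, inner ℝ (bloch (conjMap (W * U₀) (conjMap V (ρ i)))) n =
      crossNorm (fun i => bloch (ρ i)) / minusNorm (fun i => bloch (ρ i)) *
        sinTheta (fun i => bloch (ρ i)) B +
      projR (fun i => bloch (ρ i)) i / minusNorm (fun i => bloch (ρ i)) *
        cosTheta (fun i => bloch (ρ i)) B := by
    intro i
    have hh : (conjMap U₀ (conjMap V (ρ i))).IsHermitian :=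
      isHermitian_conjMap _ (isHermitian_conjMap _ (hρ i).1.isHermitian)
    have h1 := hW.inner_bloch_conjMap hh hZ
    rw [hWz, bloch_dotPauli, ← dotPauli_zAxis, bloch_dotPauli, hU, inner_smul_right,
      inner_smul_right] at h1
    rw [conjMap_mul, LinearMap.comp_apply, mul_left_cancel₀ two_ne_zero h1]
    simp [inner_vec, xAxis, zAxis]
  rw [Fin.sum_univ_two, ← key 0, ← key 1]
  conv_lhs => rw [hB0, hB1]
  rw [inner_neg_right, inner_smul_right, inner_smul_right]
  ring

lemma IsProcedureB.sum_inner_eq (hρ : ∀ i, IsDensity (ρ i)) (hne : bloch (ρ 0) ≠ bloch (ρ 1))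
    (hΩ : QubitTracking.indicator (fun i => bloch (ρ i)) B ≤ 0)
    {C : Op →ₗ[ℂ] Op} (hC : IsProcedureB ρ B C) :
    ∑ i, inner ℝ (bloch (C (ρ i))) (B i) = gammaB (fun i => bloch (ρ i)) B := by
  have hR := fun i => (hρ i).norm_bloch_le
  have h0 : 0 < minusNorm fun i => bloch (ρ i) := minusNorm_pos hne
  have hlt : (crossNorm fun i => bloch (ρ i)) < minusNorm fun i => bloch (ρ i) :=
    crossNorm_lt_minusNorm hR hne
  obtain ⟨V, U, hV, h1, h2, rfl⟩ := hC
  simp only [conjMap_mul, LinearMap.comp_apply]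
  by_cases hX : crossNorm B = 0
  · exact (h2 hX).sum_inner_eq hρ hne hΩ hX
  · have hΓ := gamma_alphaB_betaB (R := fun i => bloch (ρ i)) h0 hX
    rw [← hΓ, ← sum_inner_coeffK (hΓ ▸ gammaB_pos h0 hlt hΩ hX)]
    simp only [(h1 hX).2]

end ProcedureB

end QubitTracking

end

theorem theorem1 (ρ ρb : Fin 2 → Op) (p : Fin 2 → ℝ)
    (hρ : ∀ i, IsDensity (ρ i)) (hρb : ∀ i, IsDensity (ρb i)) (hne : ρ 0 ≠ ρ 1)
    (hp : ∀ i, 0 ≤ p i) (hp_sum : p 0 + p 1 = 1)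
    (R B : Fin 2 → Vec) (hR : R = fun i => bloch (ρ i))
    (hB : B = fun i => bloch ((p i : ℂ) • ρb i)) :
    -- the quantities entering the indicator function are real
    (0 < minusNorm R ∧ crossNorm R < minusNorm R) ∧
    -- procedure A
    (0 < QubitTracking.indicator R B →
      -- it is well defined and can be carried out
      (0 < paramS R B ∧ 0 < paramS R B + paramT R B ∧
        mu₁ R B ∈ Set.Icc 0 1 ∧ mu₂ R B ∈ Set.Icc 0 1 ∧ mu₃ R B ∈ Set.Icc 0 1 ∧
        0 < gammaA R B ∧ QubitTracking.gamma B (alphaA R B) (betaA R B) = gammaA R B) ∧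
      (∃ C, IsProcedureA ρ B C) ∧
      -- it is optimal, extremal and not unitary
      ∀ C, IsProcedureA ρ B C →
        IsOptimal ρ ρb p C ∧ merit ρ ρb p C = 1 / 2 + gammaA R B / 2 ∧
        C ∈ Set.extremePoints ℝ {C' : Op →ₗ[ℂ] Op | IsCPTP C'} ∧
        ¬ ∃ W, IsUnitary W ∧ C = conjMap W) ∧
    -- procedure B
    (QubitTracking.indicator R B ≤ 0 →
      -- it is well defined and can be carried out
      (0 ≤ plusNorm B ^ 2 - paramT R B + 2 * crossNorm R * crossNorm B ∧
        (crossNorm B ≠ 0 →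
          0 < gammaB R B ∧ QubitTracking.gamma B (alphaB R) (betaB R B) = gammaB R B) ∧
        (crossNorm B = 0 →
          (B ≠ 0 → 0 < plusNorm B ^ 2 - paramT R B) ∧ sinTheta R B ∈ Set.Icc (-1) 1)) ∧
      (∃ C, IsProcedureB ρ B C) ∧
      -- it is optimal and unitary
      ∀ C, IsProcedureB ρ B C →
        IsOptimal ρ ρb p C ∧ merit ρ ρb p C = 1 / 2 + gammaB R B / 2 ∧
        ∃ W, IsUnitary W ∧ C = conjMap W) := by
  subst hR hB
  have hRle := fun i => (hρ i).norm_bloch_le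
  have hne' := bloch_ne_of_ne (hρ 0) (hρ 1) hne
  have h0 : 0 < minusNorm fun i => bloch (ρ i) := minusNorm_pos hne'
  have hlt : (crossNorm fun i => bloch (ρ i)) < minusNorm fun i => bloch (ρ i) :=
    crossNorm_lt_minusNorm hRle hne'
  refine ⟨⟨h0, hlt⟩, fun hΩ => ⟨?_, exists_isProcedureA hρ h0 hlt hΩ, fun C hC => ?_⟩,
    fun hΩ => ⟨⟨?_, fun hX => ?_, fun hX => ?_⟩, exists_isProcedureB hρ hne' hΩ, fun C hC => ?_⟩⟩
  · exact ⟨paramS_pos hlt hΩ, paramS_add_paramT_pos hΩ, mu₁_mem hlt hΩ,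
      ⟨(mu₂_mem hΩ).1, (mu₂_mem hΩ).2.le⟩, ⟨(mu₃_mem hlt hΩ).1, (mu₃_mem hlt hΩ).2.le⟩,
      gammaA_pos hlt hΩ, gamma_alphaA_betaA hlt hΩ⟩
  · obtain ⟨h1, h2⟩ := isOptimal_of_sum_inner_eq hρ hρb hp_sum (hC.isCPTP hlt hΩ)
      (hC.sum_inner_eq hlt hΩ) fun C' hC' => sum_inner_le_gammaA _ hρ hne hΩ hC'
    exact ⟨h1, h2, hC.mem_extremePoints h0 hlt hΩ, hC.ne_conjMap hlt hΩ⟩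
  · exact add_nonneg (gammaB_radicand_nonneg h0)
      (mul_nonneg (mul_nonneg zero_le_two (crossNorm_nonneg _)) (crossNorm_nonneg _))
  · exact ⟨gammaB_pos h0 hlt hΩ hX, gamma_alphaB_betaB h0 hX⟩
  · refine ⟨plusNorm_sq_sub_pos h0 hlt hΩ hX, ?_⟩
    exact abs_le.1 ((sq_le_one_iff_abs_le_one _).1
      (sinTheta_sq_le_one h0 (inner_eq_neg_of_indicator_nonpos hRle hne' hΩ hX)))
  · obtain ⟨W, hW, hCW⟩ := hC.exists_unitary
    obtain ⟨h1, h2⟩ := isOptimal_of_sum_inner_eq hρ hρb hp_sum (hCW ▸ hW.isCPTP_conjMap)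
      (hC.sum_inner_eq hρ hne' hΩ) fun C' hC' => sum_inner_le_gammaB _ hρ hne hΩ hC'
    exact ⟨h1, h2, W, hW, hCW⟩
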